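/- A $\mathbb Z_2$-graded $C^*$-algebra is a pair $(\mathfrak A,\theta)$ of a unital $C^*$-algebra and a $*$-automorphism $\theta$ with $\theta^2=\mathrm{id}$; put $\mathfrak A_{\pm}=\{a:\theta(a)=\pm a\}$ (even and odd elements). Let $(\mathfrak A_1,\theta_1)$ and $(\mathfrak A_2,\theta_2)$ be $\mathbb Z_2$-graded $C^*$-algebras. Their algebraic Fermi product $\mathfrak A_1\,Ⓕ\,\mathfrak A_2$ is the algebraic tensor product $\mathfrak A_1\odot\mathfrak A_2$ with the product and involution that on homogeneous elements are given by $$(a_1\otimes a_2)(b_1\otimes b_2)=\varepsilon(a_2,b_1)\,a_1b_1\otimes a_2b_2,\qquad (a_1\otimes a_2)^*=\varepsilon(a_1,a_2)\,a_1^*\otimes a_2^*,$$ where $\varepsilon(x,y)=-1$ if $x$ and $y$ are both odd and $\varepsilon(x,y)=1$ otherwise. It is graded by $(\theta_1\,Ⓕ\,\theta_2)(a_1\otimes a_2)=\theta_1(a_1)\otimes\theta_2(a_2)$. A state $\omega$ of $\mathfrak A_i$ is even if $\omega\circ\theta_i=\omega$, and $\omega_1\times\omega_2$ denotes the linear functional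 with $(\omega_1\times\omega_2)(a_1\otimes a_2)=\omega_1(a_1)\omega_2(a_2)$. A GNS representation of a linear functional $\varphi$ on a unital $*$-algebra is a $*$-representation $\pi_\varphi$ by bounded operators on a Hilbert space with a cyclic vector $\xi$ such that $\varphi(x)=\langle\xi,\pi_\varphi(x)\xi\rangle$ for all $x$ (inner product linear in the second variable); it is unique up to unitary equivalence. A $C^*$-norm $\|\cdot\|_\beta$ on $\mathfrak A_1\,Ⓕ\,\mathfrak A_2$ (a submultiplicative norm with $\|x^*x\|_\beta=\|x\|_\beta^2$) is compatible if $\theta_1\,Ⓕ\,\theta_2$ extends to a $*$-automorphism of the completion of $\mathfrak A_1\,Ⓕ\,\mathfrak A_2$ with respect to $\|\cdot\|_\beta$. Theorem. For all even states $\omega_1$ of $\mathfrak A_1$ and $\omega_2$ of $\mathfrak A_2$ the functional $\omega_1\times\omega_2$ has a GNS representation $\pi_{\omega_1\times\omega_2}$. The spatial norm $$\|x\|_{\min}:=\sup\{\|\pi_{\omega_1\times\omega_2}(x)\| : \omega_1,\omega_2\text{ even states of }\mathfrak A_1,\mathfrak A_2\},\qquad x\in\mathfrak A_1\,Ⓕ\,\mathfrak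 A_2$$ (with $\sup\emptyset=0$), is the smallest compatible $C^*$-norm on $\mathfrak A_1\,Ⓕ\,\mathfrak A_2$: it is a compatible $C^*$-norm, and $\|x\|_{\min}\le\|x\|_\beta$ for every compatible $C^*$-norm $\|\cdot\|_\beta$ on $\mathfrak A_1\,Ⓕ\,\mathfrak A_2$ and every $x\in\mathfrak A_1\,Ⓕ\,\mathfrak A_2$. -/

import Mathlib

open scoped TensorProduct ComplexOrder

universe u v

noncomputable section

theorem zmod_two_cases : ∀ i : ZMod 2, i = 0 ∨ i = 1 := by decide

/-- A `ℤ₂`-grading of a (unital) C*-algebra `A`, given by an involutive `*`-automorphism. -/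
structure Z2Grading (A : Type u) [CStarAlgebra A] where
  /-- the grading automorphism -/
  theta : A ≃⋆ₐ[ℂ] A
  involutive : ∀ a : A, theta (theta a) = a

namespace Z2Grading

variable {A : Type u} [CStarAlgebra A] (g : Z2Grading A)

/-- The homogeneous components: `component 0` is the even part `{a | θ a = a}` and `component 1`
the odd part `{a | θ a = -a}`. -/
def component (i : ZMod 2) : Submodule ℂ A where
  carrier := {a | g.theta a = if i = 0 then a else -a}
  zero_mem' := by simp
  add_mem' := by
    intro a b ha hb
    simp only [Set.mem_ofPred_eq, map_add] at *
    split_ifs at * with h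
    · rw [ha, hb]
    · rw [ha, hb, neg_add]
  smul_mem' := by
    intro c a ha
    simp only [Set.mem_ofPred_eq, map_smul] at *
    split_ifs at * with h
    · rw [ha]
    · rw [ha, smul_neg]

/-- The grading automorphism as a linear map. -/
def thetaLin : A →ₗ[ℂ] A where
  toFun := g.theta
  map_add' := map_add g.theta
  map_smul' c a := map_smul g.theta c a

/-- The projection `(id ± θ) / 2` of `A` onto its homogeneous component of degree `i`. -/
def proj (i : ZMod 2) : A →ₗ[ℂ] A :=
  (2⁻¹ : ℂ) • (LinearMap.id + (if i = 0 then (1 : ℂ) else -1) • g.thetaLin)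

theorem mem_component {i : ZMod 2} {a : A} :
    a ∈ g.component i ↔ g.theta a = if i = 0 then a else -a := Iff.rfl

theorem proj_apply (i : ZMod 2) (a : A) :
    g.proj i a = (2⁻¹ : ℂ) • (a + (if i = 0 then (1 : ℂ) else -1) • g.theta a) := rfl

theorem proj_mem (i : ZMod 2) (a : A) : g.proj i a ∈ g.component i := by
  rw [mem_component, proj_apply]
  split_ifs <;> simp [g.involutive, add_comm, ← smul_neg]

theorem proj_of_mem {i : ZMod 2} {a : A} (ha : a ∈ g.component i) (j : ZMod 2) :
    g.proj j a = if j = i then a else 0 := by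
  rw [mem_component] at ha
  rw [proj_apply, ha]
  have h2 : (2⁻¹ : ℂ) • (a + a) = a := by rw [← two_smul ℂ a, smul_smul]; norm_num
  rcases zmod_two_cases i with rfl | rfl <;> rcases zmod_two_cases j with rfl | rfl <;> simp [h2]

theorem proj_zero_add_proj_one (a : A) : g.proj 0 a + g.proj 1 a = a := by
  have h2 : (2⁻¹ : ℂ) • (a + a) = a := by rw [← two_smul ℂ a, smul_smul]; norm_num
  rw [proj_apply, proj_apply, ← smul_add]
  simp only [if_true, one_ne_zero, if_false, one_smul, neg_smul]
  rw [show a + g.theta a + (a + -g.theta a) = a + a by abel, h2]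

theorem star_mem {i : ZMod 2} {a : A} (ha : a ∈ g.component i) : star a ∈ g.component i := by
  rw [mem_component] at *
  rw [map_star, ha]
  split_ifs <;> simp

/-- The projection onto a homogeneous component, as a map into this component. -/
def projTo (i : ZMod 2) : A →ₗ[ℂ] g.component i := (g.proj i).codRestrict _ (g.proj_mem i)

theorem coe_projTo (i : ZMod 2) (a : A) : (g.projTo i a : A) = g.proj i a := rfl

theorem projTo_coe {i : ZMod 2} (a : g.component i) (j : ZMod 2) :
    g.projTo j (a : A) = if h : j = i then h ▸ a else 0 := by
  ext
  rw [coe_projTo, g.proj_of_mem a.2]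
  split_ifs with h
  · subst h
    rfl
  · rfl

/-- The two homogeneous components make `A` a `ℤ₂`-graded algebra in Mathlib's sense. -/
instance : GradedAlgebra g.component where
  one_mem := by simp [mem_component]
  mul_mem := by
    intro i j a b ha hb
    rw [mem_component] at *
    rw [map_mul, ha, hb]
    rcases zmod_two_cases i with rfl | rfl <;> rcases zmod_two_cases j with rfl | rfl <;> simp [show (1 : ZMod 2) + 1 = 0 from rfl]
  decompose' a := DirectSum.of (fun i => g.component i) 0 (g.projTo 0 a) +
    DirectSum.of (fun i => g.component i) 1 (g.projTo 1 a)
  left_inv a := by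
    simp [proj_zero_add_proj_one, coe_projTo]
  right_inv x := by
    induction x using DirectSum.induction_on with
    | zero => simp
    | of i x =>
      simp only [DirectSum.coeAddMonoidHom_of, projTo_coe]
      rcases zmod_two_cases i with rfl | rfl <;> simp
    | add x y hx hy =>
      conv_rhs => rw [← hx, ← hy]
      simp only [map_add]
      abel

end Z2Grading

/-- The sign `ε(i, j)`: it is `-1` if both degrees are odd, and `1` otherwise. -/
def koszulSign (i j : ZMod 2) : ℂ := if i = 1 ∧ j = 1 then -1 else 1

variable {A₁ : Type u} {A₂ : Type v} [CStarAlgebra A₁] [CStarAlgebra A₂]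

/-- The algebraic Fermi (graded) tensor product of two `ℤ₂`-graded C*-algebras: the linear space
`A₁ ⊗ A₂` with `(a ⊗ b) (a' ⊗ b') = ε(∂b, ∂a') (a a' ⊗ b b')` for homogeneous `b`, `a'`. -/
abbrev FermiProduct (g₁ : Z2Grading A₁) (g₂ : Z2Grading A₂) : Type (max u v) :=
  GradedTensorProduct ℂ g₁.component g₂.component

namespace FermiProduct

variable (g₁ : Z2Grading A₁) (g₂ : Z2Grading A₂)

/-- The linear identification of `A₁ ⊗ A₂` with the Fermi product. -/
abbrev ofTensor : A₁ ⊗[ℂ] A₂ ≃ₗ[ℂ] FermiProduct g₁ g₂ :=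
  GradedTensorProduct.of ℂ g₁.component g₂.component

/-- The linear map that multiplies the component of bidegree `(i, j)` by `ε(i, j)`. -/
def twist : A₁ ⊗[ℂ] A₂ →ₗ[ℂ] A₁ ⊗[ℂ] A₂ :=
  ∑ i : ZMod 2, ∑ j : ZMod 2, koszulSign i j • TensorProduct.map (g₁.proj i) (g₂.proj j)

/-- The involution `x* = ∑ ε(i, j) (x_{i,j})*` of the Fermi product. -/
instance : Star (FermiProduct g₁ g₂) where
  star x := ofTensor g₁ g₂ (star (twist g₁ g₂ ((ofTensor g₁ g₂).symm x)))

theorem star_def (x : FermiProduct g₁ g₂) :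
    star x = ofTensor g₁ g₂ (star (twist g₁ g₂ ((ofTensor g₁ g₂).symm x))) := rfl

variable {g₁ g₂}

theorem star_tmul_of_mem {i j : ZMod 2} {a : A₁} {b : A₂}
    (ha : a ∈ g₁.component i) (hb : b ∈ g₂.component j) :
    star (ofTensor g₁ g₂ (a ⊗ₜ b)) = koszulSign i j • ofTensor g₁ g₂ (star a ⊗ₜ star b) := by
  rw [star_def, ← LinearEquiv.map_smul]
  congr 1
  rw [LinearEquiv.symm_apply_apply]
  have hs : star (koszulSign i j) = koszulSign i j := by
    unfold koszulSign
    split_ifs <;> simp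
  have ht : twist g₁ g₂ (a ⊗ₜ b) = koszulSign i j • (a ⊗ₜ b) := by
    simp only [twist, LinearMap.sum_apply, LinearMap.smul_apply, TensorProduct.map_tmul,
      g₁.proj_of_mem ha, g₂.proj_of_mem hb]
    rw [Finset.sum_eq_single i, Finset.sum_eq_single j]
    · simp
    · intro k _ hk
      simp [hk]
    · simp
    · intro k _ hk
      simp [hk]
    · simp
  rw [ht, star_smul, hs, TensorProduct.star_tmul]

theorem mul_tmul_of_mem {j k : ZMod 2} (a : A₁) {b : A₂} {c : A₁} (d : A₂)
    (hb : b ∈ g₂.component j) (hc : c ∈ g₁.component k) :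
    ofTensor g₁ g₂ (a ⊗ₜ b) * ofTensor g₁ g₂ (c ⊗ₜ d) =
      koszulSign j k • ofTensor g₁ g₂ ((a * c) ⊗ₜ (b * d)) := by
  have h := GradedTensorProduct.tmul_coe_mul_coe_tmul (R := ℂ) g₁.component g₂.component a
    ⟨b, hb⟩ ⟨c, hc⟩ d
  simp only [GradedTensorProduct.tmul] at h
  rw [h]
  rcases zmod_two_cases j with rfl | rfl <;> rcases zmod_two_cases k with rfl | rfl <;> simp [koszulSign]

/-- Induction over homogeneous elementary tensors. -/
theorem induction_homogeneous {P : FermiProduct g₁ g₂ → Prop}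
    (hadd : ∀ x y, P x → P y → P (x + y))
    (hmul : ∀ (i j : ZMod 2) (a : A₁) (b : A₂), a ∈ g₁.component i → b ∈ g₂.component j →
      P (ofTensor g₁ g₂ (a ⊗ₜ b))) (x : FermiProduct g₁ g₂) : P x := by
  obtain ⟨t, rfl⟩ := (ofTensor g₁ g₂).surjective x
  induction t using TensorProduct.induction_on with
  | zero =>
    have := hmul 0 0 0 0 (Submodule.zero_mem _) (Submodule.zero_mem _)
    simpa using this
  | tmul a b =>
    rw [← g₁.proj_zero_add_proj_one a, ← g₂.proj_zero_add_proj_one b, TensorProduct.add_tmul,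
      TensorProduct.tmul_add, TensorProduct.tmul_add]
    simp only [map_add]
    refine hadd _ _ (hadd _ _ ?_ ?_) (hadd _ _ ?_ ?_) <;>
      exact hmul _ _ _ _ (g₁.proj_mem _ _) (g₂.proj_mem _ _)
  | add x y hx hy =>
    rw [map_add]
    exact hadd _ _ hx hy

theorem star_add' (x y : FermiProduct g₁ g₂) : star (x + y) = star x + star y := by
  simp [star_def]

theorem star_smul' (c : ℂ) (x : FermiProduct g₁ g₂) : star (c • x) = star c • star x := by
  simp [star_def, star_smul]

/-- The Fermi product is a `*`-algebra. -/
instance : StarRing (FermiProduct g₁ g₂) where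
  star_involutive x := by
    induction x using induction_homogeneous with
    | hadd x y hx hy => rw [star_add', star_add', hx, hy]
    | hmul i j a b ha hb =>
      rw [star_tmul_of_mem ha hb, star_smul', star_tmul_of_mem (g₁.star_mem ha) (g₂.star_mem hb),
        star_star, star_star, smul_smul]
      rcases zmod_two_cases i with rfl | rfl <;> rcases zmod_two_cases j with rfl | rfl <;> simp [koszulSign]
  star_mul x y := by
    induction x using induction_homogeneous with
    | hadd x x' hx hx' => rw [add_mul, star_add', star_add', hx, hx', mul_add]
    | hmul i j a b ha hb =>
      induction y using induction_homogeneous with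
      | hadd y y' hy hy' => rw [mul_add, star_add', star_add', hy, hy', add_mul]
      | hmul k l c d hc hd =>
        rw [mul_tmul_of_mem a d hb hc, star_smul',
          star_tmul_of_mem (SetLike.mul_mem_graded ha hc) (SetLike.mul_mem_graded hb hd),
          star_tmul_of_mem ha hb, star_tmul_of_mem hc hd, smul_mul_smul_comm,
          mul_tmul_of_mem _ _ (g₂.star_mem hd) (g₁.star_mem ha), star_mul, star_mul, smul_smul,
          smul_smul]
        congr 1
        rcases zmod_two_cases i with rfl | rfl <;> rcases zmod_two_cases j with rfl | rfl <;> rcases zmod_two_cases k with rfl | rfl <;> rcases zmod_two_cases l with rfl | rfl <;>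
          simp [koszulSign, show (1 : ZMod 2) + 1 = 0 from rfl]
  star_add := star_add'

instance : StarModule ℂ (FermiProduct g₁ g₂) where
  star_smul := star_smul'

variable (g₁ g₂) in
/-- The product grading `θ₁ Ⓕ θ₂`, `a₁ ⊗ a₂ ↦ θ₁ a₁ ⊗ θ₂ a₂`. -/
def grading : FermiProduct g₁ g₂ →ₗ[ℂ] FermiProduct g₁ g₂ :=
  (ofTensor g₁ g₂).toLinearMap ∘ₗ
    TensorProduct.map g₁.thetaLin g₂.thetaLin ∘ₗ
      (ofTensor g₁ g₂).symm.toLinearMap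

end FermiProduct

/-- An even state of a `ℤ₂`-graded unital C*-algebra: a positive, normalized linear functional
that is invariant under the grading. -/
structure EvenState {A : Type u} [CStarAlgebra A] (g : Z2Grading A) where
  /-- the underlying linear functional -/
  toFun : A →ₗ[ℂ] ℂ
  nonneg : ∀ a : A, 0 ≤ toFun (star a * a)
  map_one : toFun 1 = 1
  even : ∀ a : A, toFun (g.theta a) = toFun a

namespace EvenState

variable {g₁ : Z2Grading A₁} {g₂ : Z2Grading A₂}

/-- The product functional `ω₁ × ω₂`, `a₁ ⊗ a₂ ↦ ω₁ a₁ * ω₂ a₂`. -/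
def prod (ω₁ : EvenState g₁) (ω₂ : EvenState g₂) : FermiProduct g₁ g₂ →ₗ[ℂ] ℂ :=
  LinearMap.mul' ℂ ℂ ∘ₗ TensorProduct.map ω₁.toFun ω₂.toFun ∘ₗ
    (FermiProduct.ofTensor g₁ g₂).symm.toLinearMap

end EvenState

/-- A GNS representation of a linear functional `φ` on a unital `*`-algebra `B`: a
`*`-representation `π` by bounded operators on a Hilbert space with a cyclic vector `ξ` such that
`φ x = ⟨ξ, π x ξ⟩`. It is unique up to unitary equivalence. -/
structure GNSRep {B : Type u} [Ring B] [StarRing B] [Algebra ℂ B] (φ : B →ₗ[ℂ] ℂ) where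
  /-- the Hilbert space -/
  H : Type u
  [instNormed : NormedAddCommGroup H]
  [instInner : InnerProductSpace ℂ H]
  [instComplete : CompleteSpace H]
  /-- the representation -/
  π : B →⋆ₐ[ℂ] (H →L[ℂ] H)
  /-- the cyclic vector -/
  ξ : H
  cyclic : DenseRange fun x : B => π x ξ
  inner_eq : ∀ x : B, inner ℂ ξ (π x ξ) = φ x

attribute [instance] GNSRep.instNormed GNSRep.instInner GNSRep.instComplete

namespace FermiProduct

variable (g₁ : Z2Grading A₁) (g₂ : Z2Grading A₂)

/-- The spatial norm: the supremum of `‖π x‖` over the GNS representations `π` of the products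
`ω₁ × ω₂` of even states. -/
def spatialNorm (x : FermiProduct g₁ g₂) : ℝ :=
  sSup {r : ℝ | ∃ (ω₁ : EvenState g₁) (ω₂ : EvenState g₂) (R : GNSRep (ω₁.prod ω₂)), r = ‖R.π x‖}

end FermiProduct

/-- A C*-norm on a `*`-algebra. -/
structure IsCStarNorm {B : Type u} [Ring B] [StarRing B] [Algebra ℂ B] (N : B → ℝ) : Prop where
  add_le : ∀ x y, N (x + y) ≤ N x + N y
  smul_eq : ∀ (c : ℂ) (x : B), N (c • x) = ‖c‖ * N x
  eq_zero : ∀ x, N x = 0 → x = 0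
  mul_le : ∀ x y, N (x * y) ≤ N x * N y
  star_mul_self : ∀ x, N (star x * x) = N x ^ 2

/-- A completion of the `*`-algebra `B` for the norm `N`: a C*-algebra with a `*`-homomorphism
from `B` that has dense range and carries the norm to `N`. -/
structure CStarCompletion {B : Type u} [Ring B] [StarRing B] [Algebra ℂ B] (N : B → ℝ) where
  /-- the completed C*-algebra -/
  C : Type u
  [instCStar : CStarAlgebra C]
  /-- the canonical map -/
  ι : B →⋆ₐ[ℂ] C
  norm_ι : ∀ x, ‖ι x‖ = N x
  dense : DenseRange ι

attribute [instance] CStarCompletion.instCStar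

/-- A norm on the Fermi product is a compatible C*-norm if it is a C*-norm and the product grading
extends to a `*`-automorphism of the completion. -/
structure IsCompatibleNorm {g₁ : Z2Grading A₁} {g₂ : Z2Grading A₂} (N : FermiProduct g₁ g₂ → ℝ) :
    Prop where
  isCStarNorm : IsCStarNorm N
  extends_grading : ∃ (K : CStarCompletion N) (Θ : K.C ≃⋆ₐ[ℂ] K.C),
    ∀ x, Θ (K.ι x) = K.ι (FermiProduct.grading g₁ g₂ x)

end

/-! On products `star x * y` the signs of the Fermi product disappear under `ω₁ × ω₂`: either they
cancel or an odd element meets an even state. Hence `ω₁ × ω₂` induces the inner product of the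
tensor product of the two GNS spaces. It is therefore positive, and left multiplications are bounded
uniformly in the states, so the GNS representations exist and embed the Fermi product into an
`ℓ^∞`-product of operator algebras. Even states separate points in each factor, so the spatial norm
is definite; each `ω₁ × ω₂` is invariant under the product grading, so the grading is isometric and
extends to the completion.

For minimality let `K` be the completion of a compatible norm `N`, with the extended grading `Θ`. It
suffices to show `|(ω₁ × ω₂)(x)| ≤ N x`: then the functional extends to a positive functional on
`K`, whose GNS operators are bounded by `N` (`norm_π_le_of_norm_le`). By Krein–Milman `ω₁` may be
taken extreme among even states. The commutant of its GNS representation is then trivial or spanned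
by `1` and an odd symmetry (`commutant_dichotomy`). So `ω₁` is the average of `ψ` and `ψ ∘ θ₁`, with
`ψ` a pure state that is either even or disjoint from `ψ ∘ θ₁` (`EvenState.IsExtreme.exists_pure`).

The first factor commutes in `K` with the even part of the second, and products of nonzero elements
are nonzero. This lets `ψ` and `ω₂` (on even elements) extend to a common state `Ω` of `K`
(`exists_joint_extension`). For fixed `b` the functional `a ↦ Ω (a b)` is dominated by `ψ` when `b`
is even, so purity makes it a multiple of `ψ`. When `b` is odd it connects `ψ` with `ψ ∘ θ₁`:
disjointness kills it, and if `ψ` is even, averaging `Ω` over `Θ` does. Thus `Ω` restricts to `ψ ×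
ω₂`, and the average of `Ω` and `Ω ∘ Θ` restricts to `ω₁ × ω₂`, which is contractive for `N`. -/

noncomputable section

/-! ### Positive functionals and the GNS construction. -/

/-- The inequality `a* a ≤ ‖a‖²` written with squares only, so that a `*`-homomorphism carries it
into a `*`-algebra without an order. -/
theorem exists_star_mul_self_add_star_mul_self_eq {A : Type*} [CStarAlgebra A] (a : A) :
    ∃ c : A, star a * a + star c * c = ((‖a‖ ^ 2 : ℝ) : ℂ) • (1 : A) := by
  let _ := CStarAlgebra.spectralOrder A
  have _ := CStarAlgebra.spectralOrderedRing A
  obtain ⟨c, hc⟩ := CStarAlgebra.nonneg_iff_eq_star_mul_self.mp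
    (sub_nonneg.mpr (CStarAlgebra.star_mul_le_algebraMap_norm_sq (a := a)))
  refine ⟨c, ?_⟩
  rw [← hc, add_sub_cancel, Algebra.algebraMap_eq_smul_one, Complex.coe_smul]

/-- The identity `a* a + c* c = ‖a‖²` is pushed through `j` and sandwiched between `star y` and `y`;
the term with `c` is nonnegative. This bounds left multiplication by elements of an embedded
C*-algebra. -/
theorem map_star_mul_self_map_mul_le {A B : Type*} [CStarAlgebra A] [Ring B]
    [StarRing B] [Algebra ℂ B] {φ : B →ₗ[ℂ] ℂ}
    (hφ : ∀ x, 0 ≤ φ (star x * x)) (j : A →⋆ₐ[ℂ] B) (a : A) (y : B) :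
    (φ (star (j a * y) * (j a * y))).re ≤ ‖a‖ ^ 2 * (φ (star y * y)).re := by
  obtain ⟨c, hc⟩ := exists_star_mul_self_add_star_mul_self_eq a
  have h := congrArg (fun z => φ (star y * j z * y)) hc
  simp only [map_add, map_mul, map_star, map_smul, map_one, mul_add, add_mul, mul_smul_comm,
    smul_mul_assoc, mul_one, smul_eq_mul] at h
  have h1 := (Complex.nonneg_iff.mp (hφ (j c * y))).1
  have h2 := congrArg Complex.re h
  rw [Complex.re_ofReal_mul, Complex.add_re] at h2
  simp only [star_mul, mul_assoc] at h1 h2 ⊢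
  linarith

section PositiveFunctional

variable {B : Type u} [Ring B] [StarRing B] [Algebra ℂ B] [StarModule ℂ B]

/-- Expanding positivity at `1 + y` shows that `φ y + φ (star y)` is real; `y = x` and `y = i x`
compare imaginary and real parts. -/
theorem map_star_of_map_star_mul_self_nonneg {φ : B →ₗ[ℂ] ℂ} (hφ : ∀ x, 0 ≤ φ (star x * x))
    (x : B) : φ (star x) = star (φ x) := by
  have key (y : B) : (φ y + φ (star y)).im = 0 := by
    have h0 := (Complex.nonneg_iff.mp (hφ y)).2
    have h1 := (Complex.nonneg_iff.mp (hφ 1)).2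
    have h2 := (Complex.nonneg_iff.mp (hφ (1 + y))).2
    simp only [star_add, star_one, add_mul, mul_add, one_mul, mul_one, map_add,
      Complex.add_im] at h0 h1 h2 ⊢
    linarith
  have h1 := key x
  have h2 := key (Complex.I • x)
  simp only [star_smul, map_smul, smul_eq_mul, Complex.add_im, Complex.mul_im, Complex.star_def,
    Complex.conj_I, Complex.neg_re, Complex.neg_im, Complex.I_re, Complex.I_im] at h1 h2
  apply Complex.ext <;> simp <;> linarith

/-- A copy of the algebra that carries the semi-inner product of a positive functional. -/
def PreGNSSpace (φ : B →ₗ[ℂ] ℂ) (_ : ∀ x, 0 ≤ φ (star x * x)) : Type u := B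

namespace PreGNSSpace

variable {φ : B →ₗ[ℂ] ℂ} {hφ : ∀ x, 0 ≤ φ (star x * x)}

instance : AddCommGroup (PreGNSSpace φ hφ) := inferInstanceAs (AddCommGroup B)
instance : Module ℂ (PreGNSSpace φ hφ) := inferInstanceAs (Module ℂ B)

variable (φ hφ) in
/-- The identification of the algebra with its copy. -/
def equiv : B ≃ₗ[ℂ] PreGNSSpace φ hφ := LinearEquiv.refl ℂ _

variable (φ hφ) in
/-- The semi-inner product on the copy of the algebra. -/
abbrev core : PreInnerProductSpace.Core ℂ (PreGNSSpace φ hφ) where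
  inner x y := φ (star ((equiv φ hφ).symm x) * (equiv φ hφ).symm y)
  conj_inner_symm x y := by
    rw [← Complex.star_def, ← map_star_of_map_star_mul_self_nonneg hφ, star_mul, star_star]
  re_inner_nonneg x := (Complex.nonneg_iff.mp (hφ _)).1
  add_left _ _ _ := by rw [map_add, star_add, add_mul, map_add]
  smul_left _ _ _ := by simp

instance : SeminormedAddCommGroup (PreGNSSpace φ hφ) :=
  InnerProductSpace.Core.toSeminormedAddCommGroup (c := core φ hφ)

instance : InnerProductSpace ℂ (PreGNSSpace φ hφ) := InnerProductSpace.ofCore (core φ hφ)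

theorem inner_equiv (x y : B) : inner ℂ (equiv φ hφ x) (equiv φ hφ y) = φ (star x * y) := rfl

theorem norm_equiv_sq (x : B) : ‖equiv φ hφ x‖ ^ 2 = (φ (star x * x)).re :=
  (inner_self_eq_norm_sq (𝕜 := ℂ) (equiv φ hφ x)).symm

/-- Left multiplication as a bounded operator. -/
def mulLeft (x : B)
    (hx : ∃ C : ℝ, ∀ y, (φ (star (x * y) * (x * y))).re ≤ C * (φ (star y * y)).re) :
    PreGNSSpace φ hφ →L[ℂ] PreGNSSpace φ hφ :=
  ((equiv φ hφ).toLinearMap ∘ₗ LinearMap.mulLeft ℂ x ∘ₗ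
    (equiv φ hφ).symm.toLinearMap).mkContinuousOfExistsBound <| by
  obtain ⟨C, hC⟩ := hx
  refine ⟨√ (max C 0), fun y => ?_⟩
  obtain ⟨y, rfl⟩ := (equiv φ hφ).surjective y
  have h : ‖equiv φ hφ (x * y)‖ ^ 2 ≤ (√ (max C 0) * ‖equiv φ hφ y‖) ^ 2 := by
    rw [mul_pow, Real.sq_sqrt (le_max_right _ _), norm_equiv_sq, norm_equiv_sq]
    refine (hC y).trans (mul_le_mul_of_nonneg_right (le_max_left _ _) ?_)
    exact (Complex.nonneg_iff.mp (hφ y)).1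
  simpa using (sq_le_sq₀ (norm_nonneg _) (by positivity)).mp h

theorem mulLeft_equiv (x : B)
    (hx : ∃ C : ℝ, ∀ y, (φ (star (x * y) * (x * y))).re ≤ C * (φ (star y * y)).re) (y : B) :
    mulLeft (hφ := hφ) x hx (equiv φ hφ y) = equiv φ hφ (x * y) := rfl

end PreGNSSpace

open PreGNSSpace in
theorem norm_map_star_mul_sq_le {φ : B →ₗ[ℂ] ℂ} (hφ : ∀ x, 0 ≤ φ (star x * x)) (x y : B) :
    ‖φ (star x * y)‖ ^ 2 ≤ (φ (star x * x)).re * (φ (star y * y)).re := by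
  rw [← norm_equiv_sq (hφ := hφ), ← norm_equiv_sq (hφ := hφ), ← mul_pow,
    ← inner_equiv (hφ := hφ)]
  gcongr
  exact norm_inner_le_norm _ _

open UniformSpace PreGNSSpace in
/-- The Gelfand–Naimark–Segal construction for a positive functional on a `*`-algebra whose left
multiplications are bounded. -/
def gnsRep (φ : B →ₗ[ℂ] ℂ) (hφ : ∀ x, 0 ≤ φ (star x * x))
    (hb : ∀ x, ∃ C : ℝ, ∀ y, (φ (star (x * y) * (x * y))).re ≤ C * (φ (star y * y)).re) :
    GNSRep φ where
  H := Completion (PreGNSSpace φ hφ)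
  π := {
    toFun x := (mulLeft (hφ := hφ) x (hb x)).completion
    map_one' := by
      ext c
      induction c using Completion.induction_on with
      | hp => apply isClosed_eq <;> fun_prop
      | ih c =>
        obtain ⟨c, rfl⟩ := (equiv φ hφ).surjective c
        simp [mulLeft_equiv]
    map_mul' x y := by
      ext c
      induction c using Completion.induction_on with
      | hp => apply isClosed_eq <;> fun_prop
      | ih c =>
        obtain ⟨c, rfl⟩ := (equiv φ hφ).surjective c
        simp [mulLeft_equiv, mul_assoc]
    map_zero' := by
      ext c
      induction c using Completion.induction_on with
      | hp => apply isClosed_eq <;> fun_prop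
      | ih c =>
        obtain ⟨c, rfl⟩ := (equiv φ hφ).surjective c
        simpa [mulLeft_equiv] using Completion.coe_zero
    map_add' x y := by
      ext c
      induction c using Completion.induction_on with
      | hp => apply isClosed_eq <;> fun_prop
      | ih c =>
        obtain ⟨c, rfl⟩ := (equiv φ hφ).surjective c
        simp [mulLeft_equiv, add_mul, Completion.coe_add]
    commutes' r := by
      ext c
      induction c using Completion.induction_on with
      | hp => apply isClosed_eq <;> fun_prop
      | ih c =>
        obtain ⟨c, rfl⟩ := (equiv φ hφ).surjective c
        simp [mulLeft_equiv, Algebra.algebraMap_eq_smul_one]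
    map_star' x := by
      refine (ContinuousLinearMap.eq_adjoint_iff _ _).mpr fun c d => ?_
      induction c, d using Completion.induction_on₂ with
      | hp => apply isClosed_eq <;> fun_prop
      | ih c d =>
        obtain ⟨c, rfl⟩ := (equiv φ hφ).surjective c
        obtain ⟨d, rfl⟩ := (equiv φ hφ).surjective d
        simp [mulLeft_equiv, inner_equiv, mul_assoc] }
  ξ := (equiv φ hφ 1 : PreGNSSpace φ hφ)
  cyclic := by
    have h : (fun x : B => (mulLeft (hφ := hφ) x (hb x)).completion
        ((equiv φ hφ 1 : PreGNSSpace φ hφ) : Completion (PreGNSSpace φ hφ))) =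
        (fun y : PreGNSSpace φ hφ => (y : Completion (PreGNSSpace φ hφ))) ∘ equiv φ hφ := by
      ext x
      simp [mulLeft_equiv]
    have h2 : DenseRange (fun x : B => (mulLeft (hφ := hφ) x (hb x)).completion
        ((equiv φ hφ 1 : PreGNSSpace φ hφ) : Completion (PreGNSSpace φ hφ))) := by
      rw [h]
      exact Completion.denseRange_coe.comp (equiv φ hφ).surjective.denseRange
        (Completion.continuous_coe _)
    exact h2
  inner_eq x := by
    have h : inner ℂ ((equiv φ hφ 1 : PreGNSSpace φ hφ) : Completion (PreGNSSpace φ hφ))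
        ((mulLeft (hφ := hφ) x (hb x)).completion
          ((equiv φ hφ 1 : PreGNSSpace φ hφ) : Completion (PreGNSSpace φ hφ))) = φ x := by
      simp [mulLeft_equiv, inner_equiv]
    exact h

theorem map_star_mul_self_le {A : Type*} [CStarAlgebra A] {φ : A →ₗ[ℂ] ℂ}
    (hφ : ∀ x, 0 ≤ φ (star x * x)) (a y : A) :
    (φ (star (a * y) * (a * y))).re ≤ ‖a‖ ^ 2 * (φ (star y * y)).re :=
  map_star_mul_self_map_mul_le hφ (StarAlgHom.id ℂ A) a y

theorem norm_map_le_norm {A : Type*} [CStarAlgebra A] {φ : A →ₗ[ℂ] ℂ}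
    (hφ : ∀ x, 0 ≤ φ (star x * x)) (h1 : φ 1 = 1) (a : A) : ‖φ a‖ ≤ ‖a‖ := by
  have h := norm_map_star_mul_sq_le hφ 1 a
  have h' := map_star_mul_self_le hφ a 1
  simp only [star_one, one_mul, mul_one, h1, Complex.one_re] at h h'
  exact (sq_le_sq₀ (norm_nonneg _) (norm_nonneg _)).mp (h.trans h')

/-- The GNS representation of a positive functional on a C*-algebra. -/
def cstarGNSRep {A : Type u} [CStarAlgebra A] (φ : A →ₗ[ℂ] ℂ)
    (hφ : ∀ x, 0 ≤ φ (star x * x)) : GNSRep φ :=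
  gnsRep φ hφ fun x => ⟨_, map_star_mul_self_le hφ x⟩

end PositiveFunctional

namespace GNSRep

variable {B : Type u} [Ring B] [StarRing B] [Algebra ℂ B] {φ : B →ₗ[ℂ] ℂ}

theorem inner_apply_apply (R : GNSRep φ) (x y : B) :
    inner ℂ (R.π x R.ξ) (R.π y R.ξ) = φ (star x * y) := by
  rw [← R.inner_eq, map_mul, map_star, ContinuousLinearMap.star_eq_adjoint,
    mul_apply_eq_comp, ContinuousLinearMap.adjoint_inner_right]

theorem norm_apply_sq (R : GNSRep φ) (x : B) :
    ‖R.π x R.ξ‖ ^ 2 = (φ (star x * x)).re := by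
  rw [← R.inner_apply_apply, ← inner_self_eq_norm_sq (𝕜 := ℂ)]
  rfl

theorem apply_apply (R : GNSRep φ) (x y : B) : R.π x (R.π y R.ξ) = R.π (x * y) R.ξ := by
  rw [map_mul]
  rfl

/-- The map from the algebra to the GNS space. -/
def orbit (R : GNSRep φ) : B →ₗ[ℂ] R.H where
  toFun x := R.π x R.ξ
  map_add' x y := by simp
  map_smul' c x := by simp

theorem orbit_apply (R : GNSRep φ) (x : B) : R.orbit x = R.π x R.ξ := rfl

theorem denseRange_orbit (R : GNSRep φ) : DenseRange R.orbit := R.cyclic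

theorem apply_orbit (R : GNSRep φ) (x y : B) : R.π x (R.orbit y) = R.orbit (x * y) :=
  R.apply_apply x y

theorem inner_orbit (R : GNSRep φ) (x y : B) :
    inner ℂ (R.orbit x) (R.orbit y) = φ (star x * y) := R.inner_apply_apply x y

theorem norm_orbit_sq (R : GNSRep φ) (x : B) : ‖R.orbit x‖ ^ 2 = (φ (star x * x)).re :=
  R.norm_apply_sq x

/-- With the converse `map_star_mul_self_mul_le` this describes the operator norm through `φ` alone,
because the orbit of the cyclic vector is dense. Hence the norm does not depend on the chosen GNS
representation. -/
theorem norm_π_le (R : GNSRep φ) {x : B} {C : ℝ} (hC : 0 ≤ C)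
    (h : ∀ y, (φ (star (x * y) * (x * y))).re ≤ C ^ 2 * (φ (star y * y)).re) : ‖R.π x‖ ≤ C := by
  refine ContinuousLinearMap.opNorm_le_bound _ hC fun v => ?_
  induction v using R.denseRange_orbit.induction_on with
  | hp => exact isClosed_le (by fun_prop) (by fun_prop)
  | ih y =>
    rw [apply_orbit, ← sq_le_sq₀ (norm_nonneg _) (by positivity), mul_pow, norm_orbit_sq,
      norm_orbit_sq]
    exact h y

theorem map_star_mul_self_mul_le (R : GNSRep φ) (x y : B) :
    (φ (star (x * y) * (x * y))).re ≤ ‖R.π x‖ ^ 2 * (φ (star y * y)).re := by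
  rw [← R.norm_orbit_sq, ← R.norm_orbit_sq, ← mul_pow, ← R.apply_orbit]
  gcongr
  exact (R.π x).le_opNorm _

theorem norm_π_eq (R R' : GNSRep φ) (x : B) : ‖R.π x‖ = ‖R'.π x‖ :=
  le_antisymm (R.norm_π_le (norm_nonneg _) (R'.map_star_mul_self_mul_le x))
    (R'.norm_π_le (norm_nonneg _) (R.map_star_mul_self_mul_le x))

end GNSRep

/-! ### Contractive unital functionals are states. -/

section ContractiveFunctional

variable {C : Type*} [CStarAlgebra C]

theorem im_eq_zero_of_norm_map_le {Ω : C →ₗ[ℂ] ℂ} (hΩ : ∀ x, ‖Ω x‖ ≤ ‖x‖) (h1 : Ω 1 = 1) {h : C}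
    (hh : IsSelfAdjoint h) : (Ω h).im = 0 := by
  -- Evaluate `Ω` at `h + i t`, whose squared norm is at most `‖h‖² + t²`, while the imaginary part
  -- of the value is shifted by `t`.
  have key (t : ℝ) : ((Ω h).im + t) ^ 2 ≤ ‖h‖ ^ 2 + t ^ 2 := by
    have hs : star (h + ((t : ℂ) * Complex.I) • (1 : C)) * (h + ((t : ℂ) * Complex.I) • (1 : C)) =
        h * h + ((t ^ 2 : ℝ) : ℂ) • (1 : C) := by
      simp only [star_add, star_smul, star_one, hh.star_eq, add_mul, mul_add, smul_mul_assoc,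
        one_mul, mul_smul_comm, mul_one]
      simp only [Complex.star_def, map_mul, Complex.conj_ofReal, Complex.conj_I]
      have : (t : ℂ) * -Complex.I * (t * Complex.I) = ((t ^ 2 : ℝ) : ℂ) := by
        push_cast
        linear_combination -(t : ℂ) ^ 2 * Complex.I_mul_I
      rw [smul_add, smul_smul, mul_comm ((t : ℂ) * Complex.I), this]
      module
    have hn : ‖h + ((t : ℂ) * Complex.I) • (1 : C)‖ ^ 2 ≤ ‖h‖ ^ 2 + t ^ 2 * ‖(1 : C)‖ := by
      rw [sq, ← CStarRing.norm_star_mul_self, hs]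
      refine (norm_add_le _ _).trans (add_le_add ?_ ?_)
      · rw [sq]
        exact norm_mul_le _ _
      · rw [norm_smul, Complex.norm_real, Real.norm_of_nonneg (sq_nonneg t)]
    have hone : ‖(1 : C)‖ ≤ 1 := by
      rcases subsingleton_or_nontrivial C with hC | hC
      · simp [Subsingleton.elim (1 : C) 0]
      · exact CStarRing.norm_one.le
    have h2 := hΩ (h + ((t : ℂ) * Complex.I) • (1 : C))
    rw [map_add, map_smul, h1, smul_eq_mul, mul_one] at h2
    have h3 := Complex.abs_im_le_norm (Ω h + t * Complex.I)
    simp only [Complex.add_im, Complex.mul_im, Complex.ofReal_re, Complex.I_im, mul_one,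
      Complex.ofReal_im, Complex.I_re, mul_zero, add_zero] at h3
    calc ((Ω h).im + t) ^ 2 = |(Ω h).im + t| ^ 2 := (sq_abs _).symm
      _ ≤ ‖h + ((t : ℂ) * Complex.I) • (1 : C)‖ ^ 2 := by
        gcongr
        exact h3.trans h2
      _ ≤ _ := hn.trans (by nlinarith [sq_nonneg t])
  by_contra hne
  -- This `t` makes the cross term `2 t Im (Ω h)` equal to `‖h‖² + 1`, too large for `key`.
  have h1 := key ((‖h‖ ^ 2 + 1) / (2 * (Ω h).im))
  have h2 : 2 * (Ω h).im * ((‖h‖ ^ 2 + 1) / (2 * (Ω h).im)) = ‖h‖ ^ 2 + 1 := by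
    field_simp
  nlinarith [sq_nonneg (Ω h).im]

/-- Since `0 ≤ ‖x‖² - x* x ≤ ‖x‖²`, contractivity gives `‖x‖² - Re Ω(x* x) ≤ ‖x‖²`. -/
theorem nonneg_of_norm_map_le {Ω : C →ₗ[ℂ] ℂ} (hΩ : ∀ x, ‖Ω x‖ ≤ ‖x‖) (h1 : Ω 1 = 1) (x : C) :
    0 ≤ Ω (star x * x) := by
  let _ := CStarAlgebra.spectralOrder C
  have _ := CStarAlgebra.spectralOrderedRing C
  rw [Complex.nonneg_iff]
  refine ⟨?_, (im_eq_zero_of_norm_map_le hΩ h1 (IsSelfAdjoint.star_mul_self x)).symm⟩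
  have hle : algebraMap ℝ C (‖x‖ ^ 2) - star x * x ≤ algebraMap ℝ C (‖x‖ ^ 2) :=
    sub_le_self _ (star_mul_self_nonneg x)
  have h0 : 0 ≤ algebraMap ℝ C (‖x‖ ^ 2) - star x * x :=
    sub_nonneg.mpr CStarAlgebra.star_mul_le_algebraMap_norm_sq
  have hn := (CStarAlgebra.norm_le_iff_le_algebraMap _ (sq_nonneg ‖x‖) h0).mpr hle
  have h2 := (Complex.re_le_norm _).trans ((hΩ _).trans hn)
  rw [map_sub, Algebra.algebraMap_eq_smul_one, ← Complex.coe_smul, map_smul, h1] at h2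
  simp only [smul_eq_mul, mul_one, Complex.sub_re, Complex.ofReal_re] at h2
  linarith

end ContractiveFunctional

/-! ### Joint extension of states from commuting, independent subalgebras. -/

section Independence

variable {A : Type*} [CStarAlgebra A]

/-- The positive part of `h - r` replaces the spectral projection of `h` above `r`: it is nonzero
because `r < ‖h‖`. An automorphism fixing `h` fixes it by uniqueness of the decomposition into
positive and negative parts. -/
theorem exists_nonneg_smul_le_mul [PartialOrder A] [StarOrderedRing A] {h : A} (hh : 0 ≤ h)
    {r : ℝ} (hr0 : 0 ≤ r) (hr : r < ‖h‖) :
    ∃ x : A, 0 ≤ x ∧ x ≠ 0 ∧ Commute h x ∧ (r • x ≤ h * x) ∧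
      ∀ θ : A ≃⋆ₐ[ℂ] A, θ h = h → θ x = x := by
  have hsa : IsSelfAdjoint (h - algebraMap ℝ A r) :=
    hh.isSelfAdjoint.sub (IsSelfAdjoint.algebraMap A (.all r))
  have hmul : (h - algebraMap ℝ A r) * (h - algebraMap ℝ A r)⁺ =
      (h - algebraMap ℝ A r)⁺ * (h - algebraMap ℝ A r)⁺ := by
    have h1 := congrArg (· * (h - algebraMap ℝ A r)⁺) (CFC.posPart_sub_negPart _ hsa)
    simpa [sub_mul _ _ (h - algebraMap ℝ A r)⁺, CFC.negPart_mul_posPart] using h1.symm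
  have hx0 : 0 ≤ (h - algebraMap ℝ A r)⁺ := CFC.posPart_nonneg _
  have hmul' : h * (h - algebraMap ℝ A r)⁺ =
      r • (h - algebraMap ℝ A r)⁺ + (h - algebraMap ℝ A r)⁺ * (h - algebraMap ℝ A r)⁺ := by
    rw [← hmul, sub_mul, Algebra.algebraMap_eq_smul_one, smul_mul_assoc, one_mul]
    abel
  refine ⟨(h - algebraMap ℝ A r)⁺, hx0, fun h0 => ?_, ?_, ?_, ?_⟩
  · have hle : h ≤ algebraMap ℝ A r := by
      rw [← sub_nonpos]
      exact (CFC.posPart_eq_zero_iff _ hsa).mp h0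
    exact absurd ((CStarAlgebra.norm_le_iff_le_algebraMap h hr0 hh).mpr hle) (not_le.mpr hr)
  · have h1 := congrArg star hmul'
    rw [star_mul, star_add, star_smul, star_mul, hx0.isSelfAdjoint.star_eq,
      hh.isSelfAdjoint.star_eq] at h1
    rw [Commute, SemiconjBy, hmul', h1]
    simp
  · rw [hmul']
    exact le_add_of_nonneg_right (Commute.mul_nonneg hx0 hx0 rfl)
  · intro θ hθ
    have hθr : θ (h - algebraMap ℝ A r) = h - algebraMap ℝ A r := by
      rw [map_sub, hθ, Algebra.algebraMap_eq_smul_one, ← Complex.coe_smul, map_smul, map_one]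
    refine (CFC.posPart_negPart_unique (c := θ (h - algebraMap ℝ A r)⁻) ?_ ?_ ?_ ?_).1.symm
    · rw [← map_sub, CFC.posPart_sub_negPart _ hsa, hθr]
    · rw [← map_mul, CFC.posPart_mul_negPart, map_zero]
    · exact map_nonneg θ hx0
    · exact map_nonneg θ (CFC.negPart_nonneg _)

variable {A' C : Type*} [CStarAlgebra A'] [CStarAlgebra C]

/-- If `x` and `y` live where `h` and `k` are nearly maximal, then `(h + k) x y ≥ (r + s) x y ≥ 0`
with `x y ≠ 0`, so the norm is at least `r + s`. Only the fixed points of `θ` commute with the image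
of `i`, hence `y` must be fixed by `θ`. -/
theorem norm_add_norm_le_norm_add [PartialOrder A] [StarOrderedRing A] [PartialOrder A']
    [StarOrderedRing A'] (i : A →⋆ₐ[ℂ] C) (j : A' →⋆ₐ[ℂ] C) (θ : A' ≃⋆ₐ[ℂ] A')
    (hcomm : ∀ a b, θ b = b → Commute (i a) (j b))
    (hne : ∀ a b, a ≠ 0 → b ≠ 0 → i a * j b ≠ 0) {h : A} {k : A'} (hh : 0 ≤ h) (hk : 0 ≤ k)
    (hh0 : h ≠ 0) (hk0 : k ≠ 0) (hθk : θ k = k) : ‖h‖ + ‖k‖ ≤ ‖i h + j k‖ := by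
  let _ := CStarAlgebra.spectralOrder C
  have _ := CStarAlgebra.spectralOrderedRing C
  have key (r s : ℝ) (hr : 0 ≤ r) (hs : 0 ≤ s) (hr' : r < ‖h‖) (hs' : s < ‖k‖) :
      r + s ≤ ‖i h + j k‖ := by
    obtain ⟨x, hx, hx0, hhx, hrx, -⟩ := exists_nonneg_smul_le_mul hh hr hr'
    obtain ⟨y, hy, hy0, hky, hsy, hθy⟩ := exists_nonneg_smul_le_mul hk hs hs'
    have hyθ := hθy θ hθk
    have hxy : 0 ≤ i x * j y := Commute.mul_nonneg (map_nonneg i hx) (map_nonneg j hy)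
      (hcomm x y hyθ)
    have e1 : 0 ≤ i (h * x - r • x) * j y := Commute.mul_nonneg
      (map_nonneg i (sub_nonneg.mpr hrx)) (map_nonneg j hy) (hcomm _ y hyθ)
    have hθky : θ (k * y - s • y) = k * y - s • y := by
      rw [map_sub, map_mul, hθk, hyθ, ← Complex.coe_smul, map_smul, hyθ]
    have e2 : 0 ≤ i x * j (k * y - s • y) := Commute.mul_nonneg
      (map_nonneg i hx) (map_nonneg j (sub_nonneg.mpr hsy)) (hcomm x _ hθky)
    have hle : (r + s) • (i x * j y) ≤ (i h + j k) * (i x * j y) := by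
      rw [← sub_nonneg]
      convert add_nonneg e1 e2 using 1
      rw [map_sub, map_sub, map_mul, map_mul, ← Complex.coe_smul, ← Complex.coe_smul,
        ← Complex.coe_smul, map_smul, map_smul, add_mul (i h), ← mul_assoc (j k),
        ← (hcomm x k hθk).eq]
      push_cast
      rw [add_smul, sub_mul, mul_sub, smul_mul_assoc, mul_smul_comm, mul_assoc, mul_assoc]
      abel
    have hn := CStarAlgebra.norm_le_norm_of_nonneg_of_le (smul_nonneg (add_nonneg hr hs) hxy) hle
    rw [norm_smul, Real.norm_of_nonneg (add_nonneg hr hs)] at hn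
    exact le_of_mul_le_mul_right (hn.trans (norm_mul_le _ _))
      (norm_pos_iff.mpr (hne x y hx0 hy0))
  have hhp := norm_pos_iff.mpr hh0
  have hkp := norm_pos_iff.mpr hk0
  refine le_of_forall_pos_le_add fun ε hε => ?_
  have h1 := key (max 0 (‖h‖ - ε / 2)) (max 0 (‖k‖ - ε / 2)) (le_max_left _ _) (le_max_left _ _)
    (max_lt hhp (by linarith)) (max_lt hkp (by linarith))
  have h2 := le_max_right 0 (‖h‖ - ε / 2)
  have h3 := le_max_right 0 (‖k‖ - ε / 2)
  linarith

theorem re_map_star_eq {φ : A →ₗ[ℂ] ℂ} (hφ : ∀ x, 0 ≤ φ (star x * x)) (a : A) :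
    (φ (star a)).re = (φ a).re := by
  rw [map_star_of_map_star_mul_self_nonneg hφ]
  simp

/-- For self-adjoint elements a shift by a large scalar `c` reduces to positive ones: `ψ h + ω k +
2c ≤ ‖h + c‖ + ‖k + c‖ ≤ ‖i h + j k‖ + 2c`. The general case follows by passing to self-adjoint
parts. -/
theorem re_map_add_re_map_le_norm (i : A →⋆ₐ[ℂ] C) (j : A' →⋆ₐ[ℂ] C) (θ : A' ≃⋆ₐ[ℂ] A')
    (hcomm : ∀ a b, θ b = b → Commute (i a) (j b))
    (hne : ∀ a b, a ≠ 0 → b ≠ 0 → i a * j b ≠ 0) {ψ : A →ₗ[ℂ] ℂ} {ω : A' →ₗ[ℂ] ℂ}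
    (hψ : ∀ x, 0 ≤ ψ (star x * x)) (hψ1 : ψ 1 = 1) (hω : ∀ x, 0 ≤ ω (star x * x))
    (hω1 : ω 1 = 1) (a : A) {b : A'} (hb : θ b = b) : (ψ a).re + (ω b).re ≤ ‖i a + j b‖ := by
  have selfAdj (h : A) (k : A') (hh : IsSelfAdjoint h) (hk : IsSelfAdjoint k) (hθ : θ k = k) :
      (ψ h).re + (ω k).re ≤ ‖i h + j k‖ := by
    let _ := CStarAlgebra.spectralOrder A
    have _ := CStarAlgebra.spectralOrderedRing A
    let _ := CStarAlgebra.spectralOrder A'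
    have _ := CStarAlgebra.spectralOrderedRing A'
    have hone : ‖(1 : C)‖ = 1 := by
      have : Nontrivial C := by
        have h1 : (1 : A) ≠ 0 := fun h => by simp [h] at hψ1
        have h2 : (1 : A') ≠ 0 := fun h => by simp [h] at hω1
        exact ⟨_, _, hne 1 1 h1 h2⟩
      exact CStarRing.norm_one
    -- The norms make both shifted elements positive; the extra `1` makes them nonzero.
    obtain ⟨c, hc⟩ : ∃ c : ℝ, c = ‖h‖ + ‖k‖ + 1 := ⟨_, rfl⟩
    have hc0 : 0 < c := by rw [hc]; positivity
    have hh' : 0 ≤ h + algebraMap ℝ A c := by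
      have := hh.neg_algebraMap_norm_le_self
      have h2 : algebraMap ℝ A ‖h‖ ≤ algebraMap ℝ A c :=
        algebraMap_mono _ (by linarith [norm_nonneg k])
      rw [neg_le_iff_add_nonneg] at this
      exact this.trans (by gcongr)
    have hk' : 0 ≤ k + algebraMap ℝ A' c := by
      have := hk.neg_algebraMap_norm_le_self
      have h2 : algebraMap ℝ A' ‖k‖ ≤ algebraMap ℝ A' c :=
        algebraMap_mono _ (by linarith [norm_nonneg h])
      rw [neg_le_iff_add_nonneg] at this
      exact this.trans (by gcongr)
    have eh : ψ (h + algebraMap ℝ A c) = ψ h + c := by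
      rw [map_add, Algebra.algebraMap_eq_smul_one, ← Complex.coe_smul, map_smul, hψ1]
      simp
    have ek : ω (k + algebraMap ℝ A' c) = ω k + c := by
      rw [map_add, Algebra.algebraMap_eq_smul_one, ← Complex.coe_smul, map_smul, hω1]
      simp
    have nh := (Complex.re_le_norm _).trans (norm_map_le_norm hψ hψ1 (h + algebraMap ℝ A c))
    have nk := (Complex.re_le_norm _).trans (norm_map_le_norm hω hω1 (k + algebraMap ℝ A' c))
    rw [eh, Complex.add_re, Complex.ofReal_re] at nh
    rw [ek, Complex.add_re, Complex.ofReal_re] at nk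
    have nh0 := (abs_le.mp ((Complex.abs_re_le_norm _).trans (norm_map_le_norm hψ hψ1 h))).1
    have nk0 := (abs_le.mp ((Complex.abs_re_le_norm _).trans (norm_map_le_norm hω hω1 k))).1
    have hθ' : θ (k + algebraMap ℝ A' c) = k + algebraMap ℝ A' c := by
      rw [map_add, hθ, Algebra.algebraMap_eq_smul_one, ← Complex.coe_smul, map_smul, map_one]
    have key := norm_add_norm_le_norm_add i j θ hcomm hne hh' hk'
      (norm_pos_iff.mp (by linarith [norm_nonneg k])) (norm_pos_iff.mp (by linarith [norm_nonneg h]))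
      hθ'
    have esum : i (h + algebraMap ℝ A c) + j (k + algebraMap ℝ A' c) =
        (i h + j k) + ((2 * c : ℝ) : ℂ) • (1 : C) := by
      rw [map_add, map_add, Algebra.algebraMap_eq_smul_one, Algebra.algebraMap_eq_smul_one,
        ← Complex.coe_smul, ← Complex.coe_smul, map_smul, map_smul, map_one, map_one]
      push_cast
      module
    have hle := norm_add_le (i h + j k) (((2 * c : ℝ) : ℂ) • (1 : C))
    rw [norm_smul, hone, Complex.norm_real, Real.norm_of_nonneg (by positivity), ← esum] at hle
    linarith
  have h1 := selfAdj (((1 / 2 : ℝ) : ℂ) • (a + star a)) (((1 / 2 : ℝ) : ℂ) • (b + star b))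
    (by simp [IsSelfAdjoint, add_comm]) (by simp [IsSelfAdjoint, add_comm])
    (by rw [map_smul, map_add, map_star, hb])
  have e1 : (ψ (((1 / 2 : ℝ) : ℂ) • (a + star a))).re = (ψ a).re := by
    rw [map_smul, smul_eq_mul, Complex.re_ofReal_mul, map_add, Complex.add_re, re_map_star_eq hψ]
    ring
  have e2 : (ω (((1 / 2 : ℝ) : ℂ) • (b + star b))).re = (ω b).re := by
    rw [map_smul, smul_eq_mul, Complex.re_ofReal_mul, map_add, Complex.add_re, re_map_star_eq hω]
    ring
  rw [e1, e2] at h1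
  refine h1.trans ?_
  have e3 : i (((1 / 2 : ℝ) : ℂ) • (a + star a)) + j (((1 / 2 : ℝ) : ℂ) • (b + star b)) =
      ((1 / 2 : ℝ) : ℂ) • ((i a + j b) + star (i a + j b)) := by
    simp only [map_smul, map_add, map_star, star_add]
    module
  rw [e3, norm_smul, Complex.norm_real, Real.norm_of_nonneg (by norm_num)]
  have := norm_add_le (i a + j b) (star (i a + j b))
  rw [norm_star] at this
  linarith

theorem norm_map_add_map_le_norm (i : A →⋆ₐ[ℂ] C) (j : A' →⋆ₐ[ℂ] C) (θ : A' ≃⋆ₐ[ℂ] A')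
    (hcomm : ∀ a b, θ b = b → Commute (i a) (j b))
    (hne : ∀ a b, a ≠ 0 → b ≠ 0 → i a * j b ≠ 0) {ψ : A →ₗ[ℂ] ℂ} {ω : A' →ₗ[ℂ] ℂ}
    (hψ : ∀ x, 0 ≤ ψ (star x * x)) (hψ1 : ψ 1 = 1) (hω : ∀ x, 0 ≤ ω (star x * x))
    (hω1 : ω 1 = 1) (a : A) {b : A'} (hb : θ b = b) : ‖ψ a + ω b‖ ≤ ‖i a + j b‖ := by
  obtain ⟨u, hu, hu'⟩ : ∃ u : ℂ, ‖u‖ = 1 ∧ u * (ψ a + ω b) = ‖ψ a + ω b‖ := by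
    by_cases h0 : ψ a + ω b = 0
    · exact ⟨1, by simp, by simp [h0]⟩
    · have h1 : (‖ψ a + ω b‖ : ℂ) ≠ 0 := by simpa using h0
      refine ⟨‖ψ a + ω b‖ / (ψ a + ω b), ?_, by field_simp⟩
      rw [norm_div, Complex.norm_real, norm_norm, div_self (norm_ne_zero_iff.mpr h0)]
  have h := re_map_add_re_map_le_norm i j θ hcomm hne hψ hψ1 hω hω1 (u • a) (b := u • b)
    (by rw [map_smul, hb])
  rw [map_smul, map_smul, map_smul, map_smul, ← smul_add, norm_smul, hu, one_mul, ← Complex.add_re,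
    ← smul_add, smul_eq_mul, hu', Complex.ofReal_re] at h
  exact h

/-- Commuting, qualitatively independent C*-subalgebras have joint extensions of states. -/
theorem exists_joint_extension (i : A →⋆ₐ[ℂ] C) (j : A' →⋆ₐ[ℂ] C) (θ : A' ≃⋆ₐ[ℂ] A')
    (hcomm : ∀ a b, θ b = b → Commute (i a) (j b))
    (hne : ∀ a b, a ≠ 0 → b ≠ 0 → i a * j b ≠ 0) {ψ : A →ₗ[ℂ] ℂ} {ω : A' →ₗ[ℂ] ℂ}
    (hψ : ∀ x, 0 ≤ ψ (star x * x)) (hψ1 : ψ 1 = 1) (hω : ∀ x, 0 ≤ ω (star x * x))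
    (hω1 : ω 1 = 1) :
    ∃ Ω : C →ₗ[ℂ] ℂ, (∀ x, 0 ≤ Ω (star x * x)) ∧ Ω 1 = 1 ∧ (∀ a, Ω (i a) = ψ a) ∧
      ∀ b, θ b = b → Ω (j b) = ω b := by
  let E : Submodule ℂ A' := LinearMap.eqLocus (θ : A' →ₗ[ℂ] A') LinearMap.id
  have hE (b : E) : θ (b : A') = b := b.2
  let L : A × E →ₗ[ℂ] C := LinearMap.coprod (i : A →ₗ[ℂ] C) ((j : A' →ₗ[ℂ] C) ∘ₗ E.subtype)
  let f : A × E →ₗ[ℂ] ℂ := LinearMap.coprod ψ (ω ∘ₗ E.subtype)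
  have hL (p : A × E) : L p = i p.1 + j p.2 := rfl
  have hf (p : A × E) : f p = ψ p.1 + ω p.2 := rfl
  have hbd (p : A × E) : ‖f p‖ ≤ ‖L p‖ := by
    rw [hL, hf]
    exact norm_map_add_map_le_norm i j θ hcomm hne hψ hψ1 hω hω1 _ (hE p.2)
  -- `L` is not injective, since both subalgebras contain the scalars. By `hbd`, `f` vanishes on the
  -- kernel of `L` and so descends to its range, where it is contractive; Hahn–Banach does the rest.
  obtain ⟨g, hg⟩ : ∃ g : C →ₗ[ℂ] ℂ, g ∘ₗ L = f := by
    have hmem : f ∈ LinearMap.range L.dualMap := by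
      rw [LinearMap.range_dualMap_eq_dualAnnihilator_ker, Submodule.mem_dualAnnihilator]
      intro p hp
      have := hbd p
      rw [LinearMap.mem_ker.mp hp, norm_zero] at this
      exact norm_le_zero_iff.mp this
    exact hmem
  have hg' (p : A × E) : g (L p) = f p := LinearMap.congr_fun hg p
  let G : StrongDual ℂ (LinearMap.range L) :=
    (g ∘ₗ (LinearMap.range L).subtype).mkContinuous 1 <| by
      rintro ⟨_, p, rfl⟩
      rw [one_mul]
      change ‖g (L p)‖ ≤ ‖L p‖
      rw [hg']
      exact hbd p
  have hG : ‖G‖ ≤ 1 := LinearMap.mkContinuous_norm_le _ zero_le_one _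
  obtain ⟨Ω, hΩ, hΩn⟩ := exists_extension_norm_eq (LinearMap.range L) G
  have hΩL (p : A × E) : Ω (L p) = f p :=
    (hΩ ⟨L p, p, rfl⟩).trans (hg' p)
  have hΩi (a : A) : Ω (i a) = ψ a := by
    have := hΩL (a, 0)
    simpa [hL, hf] using this
  have hΩ1 : Ω 1 = 1 := by rw [← map_one i, hΩi, hψ1]
  have hle (x : C) : ‖Ω x‖ ≤ ‖x‖ := by
    have := Ω.le_of_opNorm_le (hΩn.trans_le hG) x
    simpa using this
  refine ⟨Ω.toLinearMap, nonneg_of_norm_map_le (Ω := Ω.toLinearMap) hle hΩ1, hΩ1, hΩi,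
    fun b hb => ?_⟩
  have := hΩL (0, ⟨b, hb⟩)
  simpa [hL, hf] using this

/-- Because `‖1 + a* a‖ = 1 + ‖a* a‖`, a norming functional of `1 + a* a` must take the value `1` at
`1`, so it is a state, and the value `‖a* a‖` at `a* a`. -/
theorem exists_map_star_mul_self_ne_zero {a : A} (ha : a ≠ 0) :
    ∃ ω : A →ₗ[ℂ] ℂ, (∀ x, 0 ≤ ω (star x * x)) ∧ ω 1 = 1 ∧ ω (star a * a) ≠ 0 := by
  have : Nontrivial A := ⟨a, 0, ha⟩
  let _ := CStarAlgebra.spectralOrder A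
  have _ := CStarAlgebra.spectralOrderedRing A
  obtain ⟨g, hg, hga⟩ := exists_dual_vector'' ℂ (1 + star a * a)
  have hle (x : A) : ‖g x‖ ≤ ‖x‖ := by simpa using g.le_of_opNorm_le hg x
  have hn : 1 + ‖star a * a‖ ≤ ‖1 + star a * a‖ := by
    have h0 : (1 : A) ≤ 1 + star a * a := le_add_of_nonneg_right (star_mul_self_nonneg a)
    have h1 : 1 ≤ ‖1 + star a * a‖ := by
      simpa using CStarAlgebra.norm_le_norm_of_nonneg_of_le zero_le_one h0
    have h2 := (CStarAlgebra.norm_le_iff_le_algebraMap _ (norm_nonneg _)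
      (zero_le_one.trans h0)).mp le_rfl
    have h3 : ‖star a * a‖ ≤ ‖1 + star a * a‖ - 1 := by
      rw [CStarAlgebra.norm_le_iff_le_algebraMap _ (sub_nonneg.mpr h1) (star_mul_self_nonneg a),
        map_sub, map_one, le_sub_iff_add_le']
      exact h2
    linarith
  have h1 := (Complex.re_le_norm _).trans (hle 1)
  have h2 := (Complex.re_le_norm _).trans (hle (star a * a))
  rw [CStarRing.norm_one] at h1
  have h3 := congrArg Complex.re hga
  rw [map_add, Complex.add_re] at h3
  change _ = ‖1 + star a * a‖ at h3
  have hre : (g 1).re = 1 := by linarith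
  have hone : g 1 = 1 := by
    have h4 := hle 1
    rw [CStarRing.norm_one] at h4
    have h5 := Complex.sq_norm (g 1)
    rw [Complex.normSq_apply, hre] at h5
    have him : (g 1).im = 0 := by nlinarith [norm_nonneg (g 1)]
    exact Complex.ext hre him
  refine ⟨g.toLinearMap, nonneg_of_norm_map_le (Ω := g.toLinearMap) hle hone, hone, fun h0 => ?_⟩
  have h6 : (g (star a * a)).re = 0 := by
    change g (star a * a) = 0 at h0
    rw [h0, Complex.zero_re]
  have h7 : 0 < ‖star a * a‖ := by
    rw [CStarRing.norm_star_mul_self]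
    have := norm_pos_iff.mpr ha
    positivity
  linarith

end Independence

/-! ### Even states, the two factors of the Fermi product, and product functionals. -/

variable {A₁ : Type u} {A₂ : Type v} [CStarAlgebra A₁] [CStarAlgebra A₂]

theorem EvenState.map_eq_zero_of_mem {g : Z2Grading A₁} (ω : EvenState g) {a : A₁}
    (ha : a ∈ g.component 1) : ω.toFun a = 0 := by
  have h1 := ω.even a
  rw [(g.mem_component).mp ha] at h1
  simp only [one_ne_zero, if_false, map_neg] at h1
  exact self_eq_neg.mp h1.symm

/-- Average a separating state with its image under the grading; both summands are nonnegative at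
`star a * a`, so nothing cancels. -/
theorem EvenState.exists_map_star_mul_self_ne_zero (g : Z2Grading A₁) {a : A₁} (ha : a ≠ 0) :
    ∃ ω : EvenState g, ω.toFun (star a * a) ≠ 0 := by
  obtain ⟨ω, hω, hω1, hωa⟩ := _root_.exists_map_star_mul_self_ne_zero ha
  have hθ (x : A₁) : 0 ≤ ω (g.theta (star x * x)) := by
    rw [map_mul, map_star]
    exact hω _
  have hsum (x : A₁) : 0 ≤ ω (star x * x) + ω (g.theta (star x * x)) := add_nonneg (hω x) (hθ x)
  refine ⟨⟨(2⁻¹ : ℂ) • (ω + ω ∘ₗ g.thetaLin), fun x => ?_, ?_, fun x => ?_⟩, fun h => hωa ?_⟩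
  · exact mul_nonneg (inv_nonneg.mpr zero_le_two) (hsum x)
  · change 2⁻¹ * (ω 1 + ω (g.theta 1)) = 1
    rw [_root_.map_one g.theta, hω1]
    norm_num
  · change 2⁻¹ * (ω (g.theta x) + ω (g.theta (g.theta x))) = 2⁻¹ * (ω x + ω (g.theta x))
    rw [g.involutive, add_comm]
  · change 2⁻¹ * (ω (star a * a) + ω (g.theta (star a * a))) = 0 at h
    have h' : ω (star a * a) + ω (g.theta (star a * a)) = 0 := by simpa using h
    exact ((add_eq_zero_iff_of_nonneg (hω a) (hθ a)).mp h').1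

namespace FermiProduct

variable (g₁ : Z2Grading A₁) (g₂ : Z2Grading A₂)

/-- The inclusion `a ↦ a ⊗ 1` of the first factor. -/
def inclLeft : A₁ →⋆ₐ[ℂ] FermiProduct g₁ g₂ where
  __ := GradedTensorProduct.includeLeft g₁.component g₂.component
  map_star' a := by
    have key (i : ZMod 2) (b : A₁) (hb : b ∈ g₁.component i) :
        ofTensor g₁ g₂ (star b ⊗ₜ 1) = star (ofTensor g₁ g₂ (b ⊗ₜ 1)) := by
      rw [star_tmul_of_mem hb (SetLike.one_mem_graded g₂.component)]
      simp [koszulSign]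
    change ofTensor g₁ g₂ (star a ⊗ₜ 1) = star (ofTensor g₁ g₂ (a ⊗ₜ 1))
    rw [← g₁.proj_zero_add_proj_one a, star_add, TensorProduct.add_tmul, TensorProduct.add_tmul,
      map_add, map_add, star_add, key 0 _ (g₁.proj_mem 0 a), key 1 _ (g₁.proj_mem 1 a)]

/-- The inclusion `b ↦ 1 ⊗ b` of the second factor. -/
def inclRight : A₂ →⋆ₐ[ℂ] FermiProduct g₁ g₂ where
  __ := GradedTensorProduct.includeRight g₁.component g₂.component
  map_star' a := by
    have key (i : ZMod 2) (b : A₂) (hb : b ∈ g₂.component i) :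
        ofTensor g₁ g₂ (1 ⊗ₜ star b) = star (ofTensor g₁ g₂ (1 ⊗ₜ b)) := by
      rw [star_tmul_of_mem (SetLike.one_mem_graded g₁.component) hb]
      simp [koszulSign]
    change ofTensor g₁ g₂ (1 ⊗ₜ star a) = star (ofTensor g₁ g₂ (1 ⊗ₜ a))
    rw [← g₂.proj_zero_add_proj_one a, star_add, TensorProduct.tmul_add, TensorProduct.tmul_add,
      map_add, map_add, star_add, key 0 _ (g₂.proj_mem 0 a), key 1 _ (g₂.proj_mem 1 a)]

variable {g₁ g₂}

theorem inclLeft_apply (a : A₁) : inclLeft g₁ g₂ a = ofTensor g₁ g₂ (a ⊗ₜ 1) := rfl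

theorem inclRight_apply (b : A₂) : inclRight g₁ g₂ b = ofTensor g₁ g₂ (1 ⊗ₜ b) := rfl

theorem inclLeft_mul_inclRight (a : A₁) (b : A₂) :
    inclLeft g₁ g₂ a * inclRight g₁ g₂ b = ofTensor g₁ g₂ (a ⊗ₜ b) := by
  rw [inclLeft_apply, inclRight_apply, mul_tmul_of_mem a b (SetLike.one_mem_graded g₂.component)
    (SetLike.one_mem_graded g₁.component)]
  simp [koszulSign]

theorem inclRight_mul_inclLeft_of_even (a : A₁) {b : A₂} (hb : b ∈ g₂.component 0) :
    inclRight g₁ g₂ b * inclLeft g₁ g₂ a = inclLeft g₁ g₂ a * inclRight g₁ g₂ b := by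
  rw [← g₁.proj_zero_add_proj_one a, map_add, mul_add, add_mul, inclLeft_mul_inclRight,
    inclLeft_mul_inclRight, inclLeft_apply, inclLeft_apply, inclRight_apply,
    mul_tmul_of_mem _ _ hb (g₁.proj_mem 0 a), mul_tmul_of_mem _ _ hb (g₁.proj_mem 1 a)]
  simp [koszulSign]

theorem inclRight_mul_inclLeft_of_odd (a : A₁) {b : A₂} (hb : b ∈ g₂.component 1) :
    inclRight g₁ g₂ b * inclLeft g₁ g₂ a = inclLeft g₁ g₂ (g₁.theta a) * inclRight g₁ g₂ b := by
  have h0 := (g₁.mem_component).mp (g₁.proj_mem 0 a)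
  have h1 := (g₁.mem_component).mp (g₁.proj_mem 1 a)
  simp only [if_true, one_ne_zero, if_false] at h0 h1
  rw [← g₁.proj_zero_add_proj_one a, map_add, map_add, map_add, h0, h1, mul_add, add_mul, map_neg,
    neg_mul, inclLeft_mul_inclRight, inclLeft_mul_inclRight, inclLeft_apply, inclLeft_apply,
    inclRight_apply, mul_tmul_of_mem _ _ hb (g₁.proj_mem 0 a),
    mul_tmul_of_mem _ _ hb (g₁.proj_mem 1 a)]
  simp [koszulSign]

theorem grading_tmul (a : A₁) (b : A₂) :
    grading g₁ g₂ (ofTensor g₁ g₂ (a ⊗ₜ b)) =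
      ofTensor g₁ g₂ (g₁.theta a ⊗ₜ g₂.theta b) := rfl

theorem grading_tmul_of_mem {i j : ZMod 2} {a : A₁} {b : A₂} (ha : a ∈ g₁.component i)
    (hb : b ∈ g₂.component j) :
    grading g₁ g₂ (ofTensor g₁ g₂ (a ⊗ₜ b)) =
      (if i = j then (1 : ℂ) else -1) • ofTensor g₁ g₂ (a ⊗ₜ b) := by
  rw [grading_tmul, (g₁.mem_component).mp ha, (g₂.mem_component).mp hb]
  rcases zmod_two_cases i with rfl | rfl <;> rcases zmod_two_cases j with rfl | rfl <;>
    simp [TensorProduct.neg_tmul, TensorProduct.tmul_neg]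

theorem grading_grading (x : FermiProduct g₁ g₂) : grading g₁ g₂ (grading g₁ g₂ x) = x := by
  induction x using induction_homogeneous with
  | hadd x y hx hy => rw [map_add, map_add, hx, hy]
  | hmul i j a b ha hb => rw [grading_tmul, grading_tmul, g₁.involutive, g₂.involutive]

theorem grading_star (x : FermiProduct g₁ g₂) :
    grading g₁ g₂ (star x) = star (grading g₁ g₂ x) := by
  induction x using induction_homogeneous with
  | hadd x y hx hy => rw [map_add, star_add, star_add, map_add, hx, hy]
  | hmul i j a b ha hb =>
    rw [star_tmul_of_mem ha hb, map_smul, grading_tmul_of_mem (g₁.star_mem ha) (g₂.star_mem hb),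
      grading_tmul_of_mem ha hb, star_smul, star_tmul_of_mem ha hb, smul_comm]
    split_ifs <;> simp

theorem grading_mul (x y : FermiProduct g₁ g₂) :
    grading g₁ g₂ (x * y) = grading g₁ g₂ x * grading g₁ g₂ y := by
  induction x using induction_homogeneous with
  | hadd x x' hx hx' => rw [add_mul, map_add, map_add, add_mul, hx, hx']
  | hmul i j a b ha hb =>
    induction y using induction_homogeneous with
    | hadd y y' hy hy' => rw [mul_add, map_add, map_add, mul_add, hy, hy']
    | hmul k l c d hc hd =>
      rw [mul_tmul_of_mem a d hb hc, map_smul, grading_tmul_of_mem (SetLike.mul_mem_graded ha hc)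
        (SetLike.mul_mem_graded hb hd), grading_tmul_of_mem ha hb, grading_tmul_of_mem hc hd,
        smul_mul_smul_comm, mul_tmul_of_mem a d hb hc, smul_smul, smul_smul]
      congr 1
      rcases zmod_two_cases i with rfl | rfl <;> rcases zmod_two_cases j with rfl | rfl <;>
        rcases zmod_two_cases k with rfl | rfl <;> rcases zmod_two_cases l with rfl | rfl <;>
          simp [koszulSign, show (1 : ZMod 2) + 1 = 0 from rfl]

variable (g₁ g₂) in
/-- The product grading as a `*`-homomorphism. -/
def gradingHom : FermiProduct g₁ g₂ →⋆ₐ[ℂ] FermiProduct g₁ g₂ where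
  __ := AlgHom.ofLinearMap (grading g₁ g₂)
    (by
      change grading g₁ g₂ (ofTensor g₁ g₂ (1 ⊗ₜ 1)) = ofTensor g₁ g₂ (1 ⊗ₜ 1)
      rw [grading_tmul, map_one, map_one]) grading_mul
  map_star' := grading_star

end FermiProduct

namespace EvenState

open FermiProduct

variable {g₁ : Z2Grading A₁} {g₂ : Z2Grading A₂} (ω₁ : EvenState g₁) (ω₂ : EvenState g₂)

theorem prod_tmul (a : A₁) (b : A₂) :
    ω₁.prod ω₂ (ofTensor g₁ g₂ (a ⊗ₜ b)) = ω₁.toFun a * ω₂.toFun b := rfl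

theorem prod_one : ω₁.prod ω₂ 1 = 1 := by
  change ω₁.prod ω₂ (ofTensor g₁ g₂ (1 ⊗ₜ 1)) = 1
  rw [prod_tmul, ω₁.map_one, ω₂.map_one, one_mul]

theorem prod_grading (x : FermiProduct g₁ g₂) :
    ω₁.prod ω₂ (grading g₁ g₂ x) = ω₁.prod ω₂ x := by
  induction x using induction_homogeneous with
  | hadd x y hx hy => rw [map_add, map_add, map_add, hx, hy]
  | hmul i j a b ha hb => rw [grading_tmul, prod_tmul, prod_tmul, ω₁.even, ω₂.even]

/-- On products `x* y` the functional `ω₁ × ω₂` does not see the signs. -/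
theorem prod_star_tmul_mul_tmul {i j k : ZMod 2} {a c : A₁} {b : A₂} (d : A₂) (ha : a ∈ g₁.component i)
    (hb : b ∈ g₂.component j) (hc : c ∈ g₁.component k) :
    ω₁.prod ω₂ (star (ofTensor g₁ g₂ (a ⊗ₜ b)) * ofTensor g₁ g₂ (c ⊗ₜ d)) =
      ω₁.toFun (star a * c) * ω₂.toFun (star b * d) := by
  rw [star_tmul_of_mem ha hb, smul_mul_assoc, mul_tmul_of_mem _ _ (g₂.star_mem hb) hc, smul_smul,
    map_smul, prod_tmul]
  -- For equal parity of `a` and `c` the sign of the involution and that of the product coincide and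
  -- square to `1`. Otherwise `star a * c` is odd and both sides vanish.
  by_cases hik : i = k
  · subst hik
    rcases zmod_two_cases i with rfl | rfl <;> rcases zmod_two_cases j with rfl | rfl <;>
      simp [koszulSign]
  · have h1 : star a * c ∈ g₁.component 1 := by
      have h2 := SetLike.mul_mem_graded (g₁.star_mem ha) hc
      have h3 : i + k = 1 := by
        rcases zmod_two_cases i with rfl | rfl <;> rcases zmod_two_cases k with rfl | rfl <;>
          simp_all
      rwa [h3] at h2
    rw [ω₁.map_eq_zero_of_mem h1]
    simp

/-- The map from the Fermi product to the tensor product of the GNS spaces. -/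
def tensorOrbit (R₁ : GNSRep ω₁.toFun) (R₂ : GNSRep ω₂.toFun) :
    FermiProduct g₁ g₂ →ₗ[ℂ] R₁.H ⊗[ℂ] R₂.H :=
  TensorProduct.map R₁.orbit R₂.orbit ∘ₗ (ofTensor g₁ g₂).symm.toLinearMap

theorem tensorOrbit_tmul (R₁ : GNSRep ω₁.toFun) (R₂ : GNSRep ω₂.toFun) (a : A₁) (b : A₂) :
    tensorOrbit ω₁ ω₂ R₁ R₂ (ofTensor g₁ g₂ (a ⊗ₜ b)) = R₁.orbit a ⊗ₜ R₂.orbit b := rfl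

/-- The twisted algebra induces the same form as the ordinary Hilbert space tensor product;
positivity of `ω₁ × ω₂` is inherited from it. -/
theorem inner_tensorOrbit (R₁ : GNSRep ω₁.toFun) (R₂ : GNSRep ω₂.toFun)
    (x y : FermiProduct g₁ g₂) :
    inner ℂ (tensorOrbit ω₁ ω₂ R₁ R₂ x) (tensorOrbit ω₁ ω₂ R₁ R₂ y) =
      ω₁.prod ω₂ (star x * y) := by
  induction x using induction_homogeneous with
  | hadd x x' hx hx' => rw [map_add, star_add, add_mul, map_add, inner_add_left, hx, hx']
  | hmul i j a b ha hb =>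
    induction y using induction_homogeneous with
    | hadd y y' hy hy' => rw [map_add, mul_add, map_add, inner_add_right, hy, hy']
    | hmul k l c d hc hd =>
      rw [tensorOrbit_tmul, tensorOrbit_tmul, TensorProduct.inner_tmul, R₁.inner_orbit,
        R₂.inner_orbit, prod_star_tmul_mul_tmul ω₁ ω₂ d ha hb hc]

theorem prod_nonneg (x : FermiProduct g₁ g₂) : 0 ≤ ω₁.prod ω₂ (star x * x) := by
  have R₁ := cstarGNSRep _ ω₁.nonneg
  have R₂ := cstarGNSRep _ ω₂.nonneg
  rw [← inner_tensorOrbit ω₁ ω₂ R₁ R₂]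
  exact Complex.nonneg_iff.mpr
    ⟨inner_self_nonneg (𝕜 := ℂ) (x := tensorOrbit ω₁ ω₂ R₁ R₂ x),
      (inner_self_im (𝕜 := ℂ) (tensorOrbit ω₁ ω₂ R₁ R₂ x)).symm⟩

/-- The constant does not depend on the states: this makes the supremum in the spatial norm finite
and the product of all representations bounded. -/
theorem exists_bound_prod (x : FermiProduct g₁ g₂) : ∃ C : ℝ, 0 ≤ C ∧
    ∀ (ω₁ : EvenState g₁) (ω₂ : EvenState g₂) (y : FermiProduct g₁ g₂),
      (ω₁.prod ω₂ (star (x * y) * (x * y))).re ≤ C ^ 2 * (ω₁.prod ω₂ (star y * y)).re := by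
  induction x using induction_homogeneous with
  | hadd x x' hx hx' =>
    obtain ⟨C, hC, h⟩ := hx
    obtain ⟨C', hC', h'⟩ := hx'
    refine ⟨C + C', add_nonneg hC hC', fun ω₁ ω₂ y => ?_⟩
    have R₁ := cstarGNSRep _ ω₁.nonneg
    have R₂ := cstarGNSRep _ ω₂.nonneg
    have hn (z : FermiProduct g₁ g₂) :
        (ω₁.prod ω₂ (star z * z)).re = ‖tensorOrbit ω₁ ω₂ R₁ R₂ z‖ ^ 2 := by
      rw [← inner_tensorOrbit ω₁ ω₂ R₁ R₂, ← inner_self_eq_norm_sq (𝕜 := ℂ)]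
      rfl
    have h1 := h ω₁ ω₂ y
    have h2 := h' ω₁ ω₂ y
    rw [hn, hn, ← mul_pow, sq_le_sq₀ (norm_nonneg _) (by positivity)] at h1 h2 ⊢
    rw [add_mul, map_add, add_mul]
    exact (norm_add_le _ _).trans (add_le_add h1 h2)
  | hmul i j a b _ _ =>
    refine ⟨‖a‖ * ‖b‖, by positivity, fun ω₁ ω₂ y => ?_⟩
    rw [← inclLeft_mul_inclRight, mul_assoc, mul_pow, mul_assoc]
    refine (map_star_mul_self_map_mul_le (prod_nonneg ω₁ ω₂) (inclLeft g₁ g₂) a _).trans ?_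
    gcongr
    exact map_star_mul_self_map_mul_le (prod_nonneg ω₁ ω₂) (inclRight g₁ g₂) b _

/-- The GNS representation of the product of two even states. -/
def prodGNSRep : GNSRep (ω₁.prod ω₂) :=
  gnsRep _ (prod_nonneg ω₁ ω₂) fun x =>
    let ⟨C, _, h⟩ := exists_bound_prod x
    ⟨C ^ 2, h ω₁ ω₂⟩

/-- Makes the operator algebras nontrivial, as `exists_norm_eq_iSup` requires. -/
instance : Nontrivial (GNSRep.H (prodGNSRep ω₁ ω₂)) := by
  refine ⟨(prodGNSRep ω₁ ω₂).ξ, 0, fun h => ?_⟩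
  have h1 := (prodGNSRep ω₁ ω₂).inner_eq 1
  rw [prod_one, h, inner_zero_left] at h1
  exact zero_ne_one h1

end EvenState

end

open scoped ENNReal

noncomputable section

/-! ### Products of representations and completions. -/

section LpProduct

variable {I : Type*} {A : I → Type*} [∀ i, CStarAlgebra (A i)] [∀ i, Nontrivial (A i)]

instance lpCStarAlgebra : CStarAlgebra (lp A ∞) where

variable {B : Type*} [Ring B] [StarRing B] [Algebra ℂ B]

/-- The product of a uniformly bounded family of representations. -/
def lpRep (π : ∀ i, B →⋆ₐ[ℂ] A i) (hπ : ∀ x, ∃ C : ℝ, ∀ i, ‖π i x‖ ≤ C) :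
    B →⋆ₐ[ℂ] lp A ∞ where
  toFun x := ⟨fun i => π i x, memℓp_infty (by
    obtain ⟨C, hC⟩ := hπ x
    exact ⟨C, by rintro _ ⟨i, rfl⟩; exact hC i⟩)⟩
  map_one' := by ext i; simp
  map_mul' x y := by ext i; simp
  map_zero' := by ext i; simp
  map_add' x y := by ext i; exact map_add (π i) x y
  commutes' r := by ext i; simp [Algebra.algebraMap_eq_smul_one]
  map_star' x := by ext i; exact map_star (π i) x

theorem norm_lpRep (π : ∀ i, B →⋆ₐ[ℂ] A i) (hπ : ∀ x, ∃ C : ℝ, ∀ i, ‖π i x‖ ≤ C) (x : B) :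
    ‖lpRep π hπ x‖ = ⨆ i, ‖π i x‖ := lp.norm_eq_ciSup _

theorem exists_norm_eq_iSup {I : Type u} {A : I → Type u} [∀ i, CStarAlgebra (A i)]
    [∀ i, Nontrivial (A i)] (π : ∀ i, B →⋆ₐ[ℂ] A i) (hπ : ∀ x, ∃ C : ℝ, ∀ i, ‖π i x‖ ≤ C) :
    ∃ (D : Type u) (_ : CStarAlgebra D) (f : B →⋆ₐ[ℂ] D), ∀ x, ‖f x‖ = ⨆ i, ‖π i x‖ :=
  ⟨lp A ∞, lpCStarAlgebra, lpRep π hπ, norm_lpRep π hπ⟩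

end LpProduct

section Completion

variable {B : Type u} [Ring B] [StarRing B] [Algebra ℂ B]

/-- The closure of the range of a `*`-homomorphism, as a completion. -/
def closureCompletion {D : Type u} [CStarAlgebra D] (f : B →⋆ₐ[ℂ] D) {N : B → ℝ}
    (hN : ∀ x, ‖f x‖ = N x) : CStarCompletion N :=
  haveI : IsClosed (f.range.topologicalClosure : Set D) :=
    StarSubalgebra.isClosed_topologicalClosure _
  have hf (x : B) : f x ∈ f.range.topologicalClosure :=
    StarSubalgebra.le_topologicalClosure _ (Set.mem_range_self x)
  { C := f.range.topologicalClosure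
    ι := StarAlgHom.codRestrict f _ hf
    norm_ι := hN
    dense := by
      rw [DenseRange, Subtype.dense_iff]
      intro y hy
      have e : (Subtype.val '' Set.range (StarAlgHom.codRestrict f f.range.topologicalClosure hf)) =
          Set.range f := by
        rw [← Set.range_comp]
        rfl
      have hy' : y ∈ closure (Set.range f) := hy
      rw [← e] at hy'
      exact hy' }

/-- An isometric involutive `*`-endomorphism extends to the completion. -/
theorem CStarCompletion.exists_extension {N : B → ℝ} (K : CStarCompletion N)
    (σ : B →⋆ₐ[ℂ] B) (hσ : ∀ x, N (σ x) = N x) (hσσ : ∀ x, σ (σ x) = x) :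
    ∃ Θ : K.C ≃⋆ₐ[ℂ] K.C, ∀ x, Θ (K.ι x) = K.ι (σ x) := by
  let e : B →ₗ[ℂ] K.C := (K.ι : B →ₗ[ℂ] K.C)
  have hd : DenseRange e := K.dense
  let T : K.C →L[ℂ] K.C := (e ∘ₗ (σ : B →ₗ[ℂ] B)).extendOfNorm e
  have hT (x : B) : T (K.ι x) = K.ι (σ x) := LinearMap.extendOfNorm_eq hd ⟨1, fun x => by
    change ‖K.ι (σ x)‖ ≤ 1 * ‖K.ι x‖
    rw [K.norm_ι, K.norm_ι, hσ, one_mul]⟩ x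
  have hTT (x : K.C) : T (T x) = x := by
    induction x using K.dense.induction_on with
    | hp => apply isClosed_eq <;> fun_prop
    | ih x => rw [hT, hT, hσσ]
  have hmul (x y : K.C) : T (x * y) = T x * T y := by
    induction x, y using K.dense.induction_on₂ with
    | hp => apply isClosed_eq <;> fun_prop
    | h x y => rw [← map_mul, hT, hT, hT, map_mul, map_mul]
  have hstar (x : K.C) : T (star x) = star (T x) := by
    induction x using K.dense.induction_on with
    | hp => apply isClosed_eq <;> fun_prop
    | ih x => rw [← map_star, hT, hT, map_star, map_star]
  let Θ : K.C ≃⋆ₐ[ℂ] K.C :=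
    { toFun := T
      invFun := T
      left_inv := hTT
      right_inv := hTT
      map_mul' := hmul
      map_add' := map_add T
      map_star' := hstar
      map_smul' := map_smul T }
  exact ⟨Θ, hT⟩

theorem isCStarNorm_of_norm_map {D : Type*} [CStarAlgebra D] (f : B →⋆ₐ[ℂ] D) {N : B → ℝ}
    (hN : ∀ x, ‖f x‖ = N x) (h0 : ∀ x, N x = 0 → x = 0) : IsCStarNorm N where
  add_le x y := by
    simp only [← hN, map_add]
    exact norm_add_le _ _
  smul_eq c x := by
    simp only [← hN, map_smul]
    exact norm_smul _ _
  eq_zero := h0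
  mul_le x y := by
    simp only [← hN, map_mul]
    exact norm_mul_le _ _
  star_mul_self x := by
    simp only [← hN, map_mul, map_star]
    rw [CStarRing.norm_star_mul_self, sq]

end Completion

/-! ### The spatial norm is a compatible C*-norm. -/

namespace FermiProduct

variable {A₁ : Type u} {A₂ : Type v} [CStarAlgebra A₁] [CStarAlgebra A₂]

variable (g₁ : Z2Grading A₁) (g₂ : Z2Grading A₂)

theorem exists_bound_norm_π (x : FermiProduct g₁ g₂) : ∃ C : ℝ,
    ∀ p : EvenState g₁ × EvenState g₂, ‖(p.1.prodGNSRep p.2).π x‖ ≤ C := by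
  obtain ⟨C, hC, h⟩ := EvenState.exists_bound_prod x
  exact ⟨C, fun p => GNSRep.norm_π_le _ hC (h p.1 p.2)⟩

theorem spatialNorm_eq_iSup (x : FermiProduct g₁ g₂) :
    spatialNorm g₁ g₂ x =
      ⨆ p : EvenState g₁ × EvenState g₂, ‖(p.1.prodGNSRep p.2).π x‖ := by
  rw [spatialNorm, iSup]
  symm
  congr 1
  ext r
  constructor
  · rintro ⟨p, rfl⟩
    exact ⟨p.1, p.2, _, rfl⟩
  · rintro ⟨ω₁, ω₂, R, rfl⟩
    exact ⟨(ω₁, ω₂), GNSRep.norm_π_eq _ _ x⟩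

variable {g₁ g₂}

theorem norm_π_le_spatialNorm {ω₁ : EvenState g₁} {ω₂ : EvenState g₂} (R : GNSRep (ω₁.prod ω₂))
    (x : FermiProduct g₁ g₂) : ‖R.π x‖ ≤ spatialNorm g₁ g₂ x := by
  rw [spatialNorm_eq_iSup, R.norm_π_eq (ω₁.prodGNSRep ω₂)]
  obtain ⟨C, hC⟩ := exists_bound_norm_π g₁ g₂ x
  exact le_ciSup (f := fun p : EvenState g₁ × EvenState g₂ => ‖(p.1.prodGNSRep p.2).π x‖)
    ⟨C, by rintro _ ⟨p, rfl⟩; exact hC p⟩ (ω₁, ω₂)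

/-- Invariance of `ω₁ × ω₂` turns the norm estimate for `x` at the graded image of `y` into the
estimate for the graded image of `x` at `y`. -/
theorem spatialNorm_grading (x : FermiProduct g₁ g₂) :
    spatialNorm g₁ g₂ (grading g₁ g₂ x) = spatialNorm g₁ g₂ x := by
  rw [spatialNorm_eq_iSup, spatialNorm_eq_iSup]
  congr 1
  ext p
  refine le_antisymm ?_ ?_ <;> refine GNSRep.norm_π_le _ (norm_nonneg _) fun y => ?_
  · have h := (p.1.prodGNSRep p.2).map_star_mul_self_mul_le x (grading g₁ g₂ y)
    rw [← p.1.prod_grading p.2, ← p.1.prod_grading p.2 (star (grading g₁ g₂ y) * _)] at h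
    simpa only [grading_mul, grading_star, grading_grading] using h
  · have h := (p.1.prodGNSRep p.2).map_star_mul_self_mul_le (grading g₁ g₂ x) (grading g₁ g₂ y)
    rw [← p.1.prod_grading p.2, ← p.1.prod_grading p.2 (star (grading g₁ g₂ y) * _)] at h
    simpa only [grading_mul, grading_star, grading_grading] using h

/-- The slice `a ⊗ b ↦ f b • a` of the Fermi product. -/
def slice (f : A₂ →ₗ[ℂ] ℂ) : FermiProduct g₁ g₂ →ₗ[ℂ] A₁ :=
  (TensorProduct.rid ℂ A₁).toLinearMap ∘ₗ TensorProduct.map LinearMap.id f ∘ₗ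
    (ofTensor g₁ g₂).symm.toLinearMap

theorem slice_tmul (f : A₂ →ₗ[ℂ] ℂ) (a : A₁) (b : A₂) :
    slice f (ofTensor g₁ g₂ (a ⊗ₜ b)) = f b • a := rfl

/-- Slicing off the second factor lets faithfulness be checked one factor at a time. -/
theorem prod_star_tmul_mul (ω₁ : EvenState g₁) (ω₂ : EvenState g₂) (a : A₁) (b : A₂)
    (x : FermiProduct g₁ g₂) :
    ω₁.prod ω₂ (star (ofTensor g₁ g₂ (a ⊗ₜ b)) * x) =
      ω₁.toFun (star a * slice (ω₂.toFun ∘ₗ LinearMap.mulLeft ℂ (star b)) x) := by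
  have R₁ := cstarGNSRep _ ω₁.nonneg
  have R₂ := cstarGNSRep _ ω₂.nonneg
  rw [← EvenState.inner_tensorOrbit ω₁ ω₂ R₁ R₂]
  induction x using induction_homogeneous with
  | hadd x y hx hy => rw [map_add, map_add, mul_add, map_add, inner_add_right, hx, hy]
  | hmul k l c d _ _ =>
    rw [EvenState.tensorOrbit_tmul, EvenState.tensorOrbit_tmul, TensorProduct.inner_tmul,
      GNSRep.inner_orbit, GNSRep.inner_orbit, slice_tmul, mul_smul_comm, map_smul, smul_eq_mul,
      mul_comm]
    rfl

theorem eq_zero_of_spatialNorm_eq_zero {x : FermiProduct g₁ g₂}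
    (hx : spatialNorm g₁ g₂ x = 0) : x = 0 := by
  have h1 (ω₁ : EvenState g₁) (ω₂ : EvenState g₂) (y : FermiProduct g₁ g₂) :
      ω₁.prod ω₂ (star y * x) = 0 := by
    have h2 : (ω₁.prodGNSRep ω₂).π x = 0 :=
      norm_le_zero_iff.mp ((norm_π_le_spatialNorm _ x).trans hx.le)
    rw [← (ω₁.prodGNSRep ω₂).inner_orbit, GNSRep.orbit_apply _ x, h2]
    simp
  have h2 (ω₂ : EvenState g₂) (b : A₂) :
      slice (ω₂.toFun ∘ₗ LinearMap.mulLeft ℂ (star b)) x = 0 := by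
    by_contra hne
    obtain ⟨ω₁, hω₁⟩ := EvenState.exists_map_star_mul_self_ne_zero g₁ hne
    exact hω₁ (by rw [← prod_star_tmul_mul, h1])
  obtain ⟨t, rfl⟩ := (ofTensor g₁ g₂).surjective x
  -- In a basis of `A₁`, a vanishing slice forces `ω₂ (star b * b i) = 0` for every coefficient `b
  -- i`; the slice is then taken with that coefficient itself as `b`.
  let e := Module.Basis.ofVectorSpace ℂ A₁
  obtain ⟨b, rfl⟩ := TensorProduct.eq_repr_basis_left e t
  have hb : b = 0 := by
    ext i
    by_contra hne
    obtain ⟨ω₂, hω₂⟩ := EvenState.exists_map_star_mul_self_ne_zero g₂ hne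
    have h3 := h2 ω₂ (b i)
    rw [Finsupp.sum, map_sum, map_sum] at h3
    simp only [slice_tmul] at h3
    exact hω₂ (linearIndependent_iff'.mp e.linearIndependent _ _ h3 i
      (Finsupp.mem_support_iff.mpr hne))
  simp [hb]

variable (g₁ g₂) in
theorem isCompatibleNorm_spatialNorm : IsCompatibleNorm (spatialNorm g₁ g₂) := by
  obtain ⟨D, _, f, hf⟩ := exists_norm_eq_iSup
    (fun p : EvenState g₁ × EvenState g₂ => (p.1.prodGNSRep p.2).π) (exists_bound_norm_π g₁ g₂)
  have hf' (x : FermiProduct g₁ g₂) : ‖f x‖ = spatialNorm g₁ g₂ x := by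
    rw [hf, spatialNorm_eq_iSup]
  have K := closureCompletion f hf'
  exact ⟨isCStarNorm_of_norm_map f hf' fun _ => eq_zero_of_spatialNorm_eq_zero,
    K, K.exists_extension (gradingHom g₁ g₂) spatialNorm_grading grading_grading⟩

end FermiProduct

/-! ### Commutants, the implemented grading, and extreme even states. -/

namespace GNSRep

section Commutant

variable {B : Type u} [Ring B] [StarRing B] [Algebra ℂ B] {φ : B →ₗ[ℂ] ℂ} (R : GNSRep φ)

/-- The commutant of the representation. -/
def commutant : StarSubalgebra ℂ (R.H →L[ℂ] R.H) :=
  StarSubalgebra.centralizer ℂ (Set.range R.π)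

variable {R}

theorem mem_commutant_iff {X : R.H →L[ℂ] R.H} :
    X ∈ R.commutant ↔ ∀ b, R.π b * X = X * R.π b := by
  rw [commutant, StarSubalgebra.mem_centralizer_iff]
  constructor
  · exact fun h b => (h _ ⟨b, rfl⟩).1
  · rintro h _ ⟨b, rfl⟩
    refine ⟨h b, ?_⟩
    rw [← map_star]
    exact h _

theorem apply_orbit_of_mem {X : R.H →L[ℂ] R.H} (hX : X ∈ R.commutant) (b : B) :
    X (R.orbit b) = R.π b (X R.ξ) :=
  (DFunLike.congr_fun (mem_commutant_iff.mp hX b) R.ξ).symm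

theorem orbit_one : R.orbit 1 = R.ξ := by simp [orbit_apply]

theorem ext_orbit {X Y : R.H →L[ℂ] R.H} (h : ∀ b, X (R.orbit b) = Y (R.orbit b)) : X = Y :=
  ContinuousLinearMap.ext fun v => by
    induction v using R.denseRange_orbit.induction_on with
    | hp => apply isClosed_eq <;> fun_prop
    | ih b => exact h b

theorem eq_zero_of_inner_orbit {v : R.H} (h : ∀ b, inner ℂ (R.orbit b) v = 0) : v = 0 := by
  have h2 (u : R.H) : inner ℂ u v = 0 := by
    induction u using R.denseRange_orbit.induction_on with
    | hp => apply isClosed_eq <;> fun_prop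
    | ih b => exact h b
  exact inner_self_eq_zero.mp (h2 v)

theorem inner_ξ_apply (b : B) (v : R.H) :
    inner ℂ R.ξ (R.π b v) = inner ℂ (R.orbit (star b)) v := by
  rw [orbit_apply, map_star, ContinuousLinearMap.star_eq_adjoint,
    ContinuousLinearMap.adjoint_inner_left]

theorem eq_zero_of_inner_apply {X : R.H →L[ℂ] R.H} (hX : X ∈ R.commutant)
    (h : ∀ b, inner ℂ R.ξ (R.π b (X R.ξ)) = 0) : X = 0 := by
  have h0 : X R.ξ = 0 := eq_zero_of_inner_orbit fun b => by
    rw [← star_star b, ← inner_ξ_apply, h]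
  exact ext_orbit fun b => by simp [apply_orbit_of_mem hX, h0]

/-- A functional that is bounded with respect to the GNS semi-norms comes from the commutant. -/
theorem exists_mem_commutant (F : B →ₗ[ℂ] ℂ) (P Q : R.H →L[ℂ] R.H) {C : ℝ}
    (hF : ∀ a b, ‖F (star a * b)‖ ≤ C * (‖P (R.orbit a)‖ * ‖Q (R.orbit b)‖)) [StarModule ℂ B]
    (hC : 0 ≤ C) :
    ∃ X ∈ R.commutant, (∀ b, F b = inner ℂ R.ξ (R.π b (X R.ξ))) ∧
      ∀ u v, ‖inner ℂ u (X v)‖ ≤ C * (‖P u‖ * ‖Q v‖) := by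
  have hv (b : B) : ∃ v : R.H, ∀ a, inner ℂ (R.orbit a) v = F (star a * b) := by
    -- `F (star a * b)` is antilinear in `a`; its conjugate is linear and bounded, so Riesz provides
    -- the vector.
    let l : B →ₗ[ℂ] ℂ :=
      { toFun a := star (F (star a * b))
        map_add' a a' := by simp [add_mul]
        map_smul' c a := by simp }
    have hl (a : B) : l.extendOfNorm R.orbit (R.orbit a) = star (F (star a * b)) := by
      refine LinearMap.extendOfNorm_eq R.denseRange_orbit
        ⟨C * (‖P‖ * ‖Q (R.orbit b)‖), fun a => ?_⟩ a
      change ‖star (F (star a * b))‖ ≤ _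
      rw [norm_star]
      refine (hF a b).trans ?_
      have := P.le_opNorm (R.orbit a)
      calc C * (‖P (R.orbit a)‖ * ‖Q (R.orbit b)‖)
          ≤ C * ((‖P‖ * ‖R.orbit a‖) * ‖Q (R.orbit b)‖) := by gcongr
        _ = _ := by ring
    refine ⟨(InnerProductSpace.toDual ℂ R.H).symm (l.extendOfNorm R.orbit), fun a => ?_⟩
    rw [← inner_conj_symm, InnerProductSpace.toDual_symm_apply, hl]
    simp
  choose v hv using hv
  let V : B →ₗ[ℂ] R.H :=
    { toFun := v
      map_add' b b' := by
        rw [← sub_eq_zero]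
        refine eq_zero_of_inner_orbit fun a => ?_
        rw [inner_sub_right, inner_add_right, hv, hv, hv, mul_add, map_add, sub_self]
      map_smul' c b := by
        rw [← sub_eq_zero]
        refine eq_zero_of_inner_orbit fun a => ?_
        rw [inner_sub_right, RingHom.id_apply, inner_smul_right, hv, hv, mul_smul_comm, map_smul,
          smul_eq_mul, sub_self] }
  have hV (a b : B) : inner ℂ (R.orbit a) (V b) = F (star a * b) := hv b a
  have hbd (u : R.H) (b : B) : ‖inner ℂ u (V b)‖ ≤ C * (‖P u‖ * ‖Q (R.orbit b)‖) := by
    induction u using R.denseRange_orbit.induction_on with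
    | hp => exact isClosed_le (by fun_prop) (by fun_prop)
    | ih a => rw [hV]; exact hF a b
  have hVn (b : B) : ‖V b‖ ≤ C * ‖P‖ * ‖Q‖ * ‖R.orbit b‖ := by
    have h1 := hbd (V b) b
    rw [inner_self_eq_norm_sq_to_K, norm_pow, RCLike.norm_ofReal, abs_norm] at h1
    rcases (norm_nonneg (V b)).eq_or_lt with h0 | h0
    · rw [← h0]
      positivity
    · refine le_of_mul_le_mul_right ?_ h0
      calc ‖V b‖ * ‖V b‖ ≤ C * (‖P (V b)‖ * ‖Q (R.orbit b)‖) := by rwa [← sq]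
        _ ≤ C * ((‖P‖ * ‖V b‖) * (‖Q‖ * ‖R.orbit b‖)) := by
          gcongr
          · exact P.le_opNorm _
          · exact Q.le_opNorm _
        _ = _ := by ring
  let X : R.H →L[ℂ] R.H := V.extendOfNorm R.orbit
  have hX (b : B) : X (R.orbit b) = V b :=
    LinearMap.extendOfNorm_eq R.denseRange_orbit ⟨_, hVn⟩ b
  -- `X` commutes with the representation because `star a * (b * c) = star (star b * a) * c`.
  -- Keeping `P` and `Q` in the bound later shows on which subspaces `X` acts.
  refine ⟨X, mem_commutant_iff.mpr fun b => ext_orbit fun c => ?_, fun b => ?_, fun u w => ?_⟩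
  · rw [mul_apply_eq_comp, mul_apply_eq_comp, apply_orbit, hX, hX, ← sub_eq_zero]
    refine eq_zero_of_inner_orbit fun a => ?_
    rw [inner_sub_right, hV, ← star_star b, map_star, ContinuousLinearMap.star_eq_adjoint,
      ContinuousLinearMap.adjoint_inner_right, apply_orbit, hV, star_mul, star_star, mul_assoc,
      sub_self]
  · rw [inner_ξ_apply, ← orbit_one, hX, hV, star_star, mul_one]
  · induction w using R.denseRange_orbit.induction_on with
    | hp => exact isClosed_le (by fun_prop) (by fun_prop)
    | ih b => rw [hX]; exact hbd u b

end Commutant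

section Implementation

variable {A : Type u} [CStarAlgebra A] {g : Z2Grading A} {ω : EvenState g}
  (R : GNSRep ω.toFun)

/-- The unitary implementation of the grading. -/
def gradingUnitary : R.H →L[ℂ] R.H := (R.orbit ∘ₗ g.thetaLin).extendOfNorm R.orbit

variable {R}

theorem norm_orbit_theta (a : A) : ‖R.orbit (g.theta a)‖ = ‖R.orbit a‖ := by
  rw [← sq_eq_sq₀ (norm_nonneg _) (norm_nonneg _), norm_orbit_sq, norm_orbit_sq, ← map_star,
    ← map_mul, ω.even]

theorem gradingUnitary_orbit (a : A) :
    R.gradingUnitary (R.orbit a) = R.orbit (g.theta a) :=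
  LinearMap.extendOfNorm_eq R.denseRange_orbit ⟨1, fun a => by
    rw [one_mul]
    exact (norm_orbit_theta a).le⟩ a

theorem gradingUnitary_ξ : R.gradingUnitary R.ξ = R.ξ := by
  rw [← orbit_one, gradingUnitary_orbit, map_one]

theorem gradingUnitary_mul_self : R.gradingUnitary * R.gradingUnitary = 1 :=
  ext_orbit fun a => by
    rw [mul_apply_eq_comp, gradingUnitary_orbit,
      gradingUnitary_orbit, g.involutive]
    rfl

theorem star_gradingUnitary : star R.gradingUnitary = R.gradingUnitary := by
  refine ext_orbit fun a => ?_
  rw [← sub_eq_zero]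
  refine eq_zero_of_inner_orbit fun b => ?_
  rw [inner_sub_right, ContinuousLinearMap.star_eq_adjoint,
    ContinuousLinearMap.adjoint_inner_right, gradingUnitary_orbit, gradingUnitary_orbit,
    inner_orbit, inner_orbit, ← ω.even (star b * _), map_mul g.theta, g.involutive, map_star, sub_self]

theorem gradingUnitary_mul_π (a : A) :
    R.gradingUnitary * R.π a = R.π (g.theta a) * R.gradingUnitary :=
  ext_orbit fun b => by
    rw [mul_apply_eq_comp, mul_apply_eq_comp, apply_orbit, gradingUnitary_orbit, gradingUnitary_orbit,
      apply_orbit, map_mul]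

theorem gradingUnitary_conj_mem {X : R.H →L[ℂ] R.H} (hX : X ∈ R.commutant) :
    R.gradingUnitary * X * R.gradingUnitary ∈ R.commutant := by
  rw [mem_commutant_iff]
  intro a
  have h1 : R.π a * R.gradingUnitary = R.gradingUnitary * R.π (g.theta a) := by
    rw [gradingUnitary_mul_π, g.involutive]
  calc R.π a * (R.gradingUnitary * X * R.gradingUnitary)
      = R.gradingUnitary * (R.π (g.theta a) * X) * R.gradingUnitary := by
        simp only [← mul_assoc, h1]
    _ = R.gradingUnitary * X * (R.π (g.theta a) * R.gradingUnitary) := by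
        rw [mem_commutant_iff.mp hX]
        simp only [mul_assoc]
    _ = _ := by rw [← gradingUnitary_mul_π, mul_assoc _ R.gradingUnitary]

theorem inner_ξ_π_theta (a : A) (X : R.H →L[ℂ] R.H) :
    inner ℂ R.ξ (R.π (g.theta a) (X R.ξ)) =
      inner ℂ R.ξ (R.π a ((R.gradingUnitary * X * R.gradingUnitary) R.ξ)) := by
  have h1 : R.π (g.theta a) = R.gradingUnitary * R.π a * R.gradingUnitary := by
    rw [gradingUnitary_mul_π, mul_assoc, gradingUnitary_mul_self, mul_one]
  rw [h1]
  simp only [mul_apply_eq_comp, gradingUnitary_ξ]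
  rw [← ContinuousLinearMap.adjoint_inner_left, ← ContinuousLinearMap.star_eq_adjoint,
    star_gradingUnitary, gradingUnitary_ξ]

end Implementation

section Extreme

variable {A : Type u} [CStarAlgebra A] {g : Z2Grading A} {ω : EvenState g}
  {R : GNSRep ω.toFun}

/-- An even state is extreme if it is not a proper average of even states. -/
def _root_.EvenState.IsExtreme (ω : EvenState g) : Prop :=
  ∀ f₁ f₂ : EvenState g, (∀ a, f₁.toFun a + f₂.toFun a = 2 * ω.toFun a) →
    ∀ a, f₁.toFun a = ω.toFun a

theorem inner_ξ_ξ : inner ℂ R.ξ R.ξ = 1 := by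
  have h := R.inner_eq 1
  rwa [map_one, ω.map_one] at h

/-- The vector functional `a ↦ ⟨ξ, a X ξ⟩`. -/
def vectorFunctional (R : GNSRep ω.toFun) (X : R.H →L[ℂ] R.H) : A →ₗ[ℂ] ℂ where
  toFun a := inner ℂ R.ξ (R.π a (X R.ξ))
  map_add' a b := by simp
  map_smul' c a := by simp

theorem vectorFunctional_apply (X : R.H →L[ℂ] R.H) (a : A) :
    R.vectorFunctional X a = inner ℂ R.ξ (R.π a (X R.ξ)) := rfl

theorem vectorFunctional_star_mul {X : R.H →L[ℂ] R.H} (hX : X ∈ R.commutant) (a b : A) :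
    R.vectorFunctional X (star a * b) = inner ℂ (R.orbit a) (X (R.orbit b)) := by
  rw [vectorFunctional_apply, map_mul, mul_apply_eq_comp, inner_ξ_apply, star_star,
    apply_orbit_of_mem hX]

theorem vectorFunctional_one (a : A) : R.vectorFunctional 1 a = ω.toFun a := R.inner_eq a

/-- A small self-adjoint even perturbation of an even state within its commutant. -/
def perturbation (R : GNSRep ω.toFun) (X : R.H →L[ℂ] R.H) (hX : X ∈ R.commutant)
    (hs : star X = X) (hU : R.gradingUnitary * X * R.gradingUnitary = X) (hn : ‖X‖ ≤ 1)
    (h0 : inner ℂ R.ξ (X R.ξ) = 0) : EvenState g where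
  toFun := R.vectorFunctional (1 + X)
  nonneg a := by
    rw [vectorFunctional_star_mul (add_mem (one_mem _) hX), Complex.nonneg_iff,
      add_apply, inner_add_right, one_apply_eq_self]
    have him : (inner ℂ (R.orbit a) (X (R.orbit a))).im = 0 := by
      rw [← Complex.conj_eq_iff_im, inner_conj_symm]
      conv_rhs => rw [← hs, ContinuousLinearMap.star_eq_adjoint,
        ContinuousLinearMap.adjoint_inner_right]
    have hre : |(inner ℂ (R.orbit a) (X (R.orbit a))).re| ≤ ‖R.orbit a‖ ^ 2 := by
      refine (Complex.abs_re_le_norm _).trans ((norm_inner_le_norm _ _).trans ?_)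
      rw [sq]
      gcongr
      simpa using X.le_of_opNorm_le hn (R.orbit a)
    have hself : inner ℂ (R.orbit a) (R.orbit a) = ((‖R.orbit a‖ ^ 2 : ℝ) : ℂ) := by
      rw [inner_self_eq_norm_sq_to_K]
      norm_cast
    rw [hself, Complex.add_re, Complex.add_im, him, Complex.ofReal_re, Complex.ofReal_im]
    exact ⟨by linarith [(abs_le.mp hre).1], by simp⟩
  map_one := by
    rw [vectorFunctional_apply, map_one, one_apply_eq_self,
      add_apply, inner_add_right, h0, one_apply_eq_self, inner_ξ_ξ,
      add_zero]
  even a := by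
    rw [vectorFunctional_apply, inner_ξ_π_theta, mul_add, add_mul, hU, mul_one,
      gradingUnitary_mul_self, vectorFunctional_apply]

/-- Subtract the expectation of `X` and normalise to a contraction `r • T`. Then `ω` is the average
of the states given by `1 + r • T` and `1 - r • T`, which are even because `T` commutes with the
grading unitary; extremality forces `T = 0`. -/
theorem exists_eq_smul_one_of_isSelfAdjoint (hω : ω.IsExtreme) {X : R.H →L[ℂ] R.H}
    (hX : X ∈ R.commutant) (hs : star X = X)
    (hU : R.gradingUnitary * X * R.gradingUnitary = X) : ∃ c : ℂ, X = c • 1 := by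
  refine ⟨inner ℂ R.ξ (X R.ξ), ?_⟩
  set c : ℂ := inner ℂ R.ξ (X R.ξ) with hc
  have hcc : star c = c := by
    rw [hc, Complex.star_def, inner_conj_symm]
    conv_rhs => rw [← hs, ContinuousLinearMap.star_eq_adjoint,
      ContinuousLinearMap.adjoint_inner_right]
  set T := X - c • (1 : R.H →L[ℂ] R.H) with hT
  rw [← sub_eq_zero, ← hT]
  by_contra hne
  have hn : 0 < ‖T‖ := norm_pos_iff.mpr hne
  set r : ℂ := ((‖T‖⁻¹ : ℝ) : ℂ) with hr
  have hr0 : r ≠ 0 := by simpa [hr] using hne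
  have hTm : r • T ∈ R.commutant :=
    SMulMemClass.smul_mem _ (sub_mem hX (SMulMemClass.smul_mem _ (one_mem _)))
  have hTs : star (r • T) = r • T := by
    rw [star_smul, hT, star_sub, star_smul, star_one, hcc, hs, hr, Complex.star_def,
      Complex.conj_ofReal]
  have hTU : R.gradingUnitary * (r • T) * R.gradingUnitary = r • T := by
    rw [hT, mul_smul_comm, smul_mul_assoc, mul_sub, sub_mul, hU, mul_smul_comm, mul_one,
      smul_mul_assoc, gradingUnitary_mul_self]
  have hTn : ‖r • T‖ ≤ 1 := by
    rw [norm_smul, hr, Complex.norm_real, norm_inv, norm_norm, inv_mul_cancel₀ hn.ne']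
  have hT0 : inner ℂ R.ξ ((r • T) R.ξ) = 0 := by
    rw [smul_apply, inner_smul_right, hT, sub_apply,
      inner_sub_right, smul_apply, inner_smul_right,
      one_apply_eq_self, inner_ξ_ξ, ← hc]
    ring
  have key := hω (R.perturbation (r • T) hTm hTs hTU hTn hT0)
    (R.perturbation (-(r • T)) (neg_mem hTm) (by rw [star_neg, hTs])
      (by rw [mul_neg, neg_mul, hTU]) (by rwa [norm_neg])
      (by rw [neg_apply, inner_neg_right, hT0, neg_zero])) (fun a => by
        change R.vectorFunctional _ a + R.vectorFunctional _ a = _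
        rw [← vectorFunctional_one (R := R)]
        simp only [vectorFunctional_apply, add_apply,
          neg_apply, map_add, map_neg, inner_add_right, inner_neg_right]
        ring)
  have h0 : r • T = 0 := eq_zero_of_inner_apply hTm fun a => by
    have h1 : R.vectorFunctional _ a = _ := key a
    rw [← vectorFunctional_one (R := R)] at h1
    simp only [vectorFunctional_apply, add_apply, map_add,
      inner_add_right] at h1
    exact left_eq_add.mp h1.symm
  exact hne ((smul_eq_zero.mp h0).resolve_left hr0)

theorem exists_eq_smul_one (hω : ω.IsExtreme) {X : R.H →L[ℂ] R.H}
    (hX : X ∈ R.commutant) (hU : R.gradingUnitary * X * R.gradingUnitary = X) :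
    ∃ c : ℂ, X = c • 1 := by
  have hUs : R.gradingUnitary * star X * R.gradingUnitary = star X := by
    conv_rhs => rw [← hU]
    simp only [star_mul, star_gradingUnitary, mul_assoc]
  have hsX := star_mem hX
  obtain ⟨c, hc⟩ := exists_eq_smul_one_of_isSelfAdjoint hω (add_mem hX hsX)
    (by rw [star_add, star_star, add_comm]) (by rw [mul_add, add_mul, hU, hUs])
  obtain ⟨d, hd⟩ := exists_eq_smul_one_of_isSelfAdjoint hω
    (SMulMemClass.smul_mem Complex.I (sub_mem hX hsX))
    (by
      rw [star_smul, star_sub, star_star, Complex.star_def, Complex.conj_I]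
      module)
    (by rw [mul_smul_comm, smul_mul_assoc, mul_sub, sub_mul, hU, hUs])
  refine ⟨2⁻¹ * (c - Complex.I * d), ?_⟩
  rw [mul_smul, sub_smul, mul_smul, ← hc, ← hd, smul_smul, Complex.I_mul_I]
  module

/-- The commutant of an extreme even state is trivial or spanned by `1` and an odd symmetry. -/
theorem commutant_dichotomy (hω : ω.IsExtreme) :
    (∀ X ∈ R.commutant, ∃ c : ℂ, X = c • 1) ∨
    ∃ T ∈ R.commutant, star T = T ∧ T * T = 1 ∧
      R.gradingUnitary * T * R.gradingUnitary = -T ∧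
      ∀ X ∈ R.commutant, ∃ c d : ℂ, X = c • 1 + d • T := by
  have hUU (X : R.H →L[ℂ] R.H) :
      R.gradingUnitary * (R.gradingUnitary * X * R.gradingUnitary) * R.gradingUnitary = X := by
    have h := gradingUnitary_mul_self (R := R)
    calc _ = (R.gradingUnitary * R.gradingUnitary) * X * (R.gradingUnitary * R.gradingUnitary) := by
          simp only [mul_assoc]
      _ = X := by rw [h, one_mul, mul_one]
  have heven (X : R.H →L[ℂ] R.H) (hX : X ∈ R.commutant) :
      ∃ c : ℂ, X + R.gradingUnitary * X * R.gradingUnitary = c • 1 :=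
    exists_eq_smul_one hω (add_mem hX (gradingUnitary_conj_mem hX))
      (by rw [mul_add, add_mul, hUU, add_comm])
  by_cases hodd : ∃ X ∈ R.commutant, R.gradingUnitary * X * R.gradingUnitary = -X ∧ X ≠ 0
  · right
    obtain ⟨S, hS, hSs, hSU, hS0⟩ : ∃ S ∈ R.commutant, star S = S ∧
        R.gradingUnitary * S * R.gradingUnitary = -S ∧ S ≠ 0 := by
      obtain ⟨X, hX, hU, h0⟩ := hodd
      have hsX := star_mem hX
      have hUs : R.gradingUnitary * star X * R.gradingUnitary = -star X := by
        rw [← star_neg, ← hU]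
        simp only [star_mul, star_gradingUnitary, mul_assoc]
      -- One of the real and imaginary parts of a nonzero odd element is nonzero, and both are odd.
      by_cases h1 : X + star X = 0
      · refine ⟨Complex.I • (X - star X), SMulMemClass.smul_mem _ (sub_mem hX hsX), ?_, ?_, ?_⟩
        · rw [star_smul, star_sub, star_star, Complex.star_def, Complex.conj_I]
          module
        · rw [mul_smul_comm, smul_mul_assoc, mul_sub, sub_mul, hU, hUs]
          module
        · intro h2
          have h3 := (smul_eq_zero.mp h2).resolve_left Complex.I_ne_zero
          refine h0 ?_
          have h4 : X = (2⁻¹ : ℂ) • ((X + star X) + (X - star X)) := by module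
          rw [h4, h1, h3, add_zero, smul_zero]
      · refine ⟨X + star X, add_mem hX hsX, by rw [star_add, star_star, add_comm], ?_, h1⟩
        rw [mul_add, add_mul, hU, hUs, neg_add]
    have hmulU (X Y : R.H →L[ℂ] R.H) : R.gradingUnitary * (X * Y) * R.gradingUnitary =
        (R.gradingUnitary * X * R.gradingUnitary) *
          (R.gradingUnitary * Y * R.gradingUnitary) := by
      have h := gradingUnitary_mul_self (R := R)
      calc _ = R.gradingUnitary * X * 1 * Y * R.gradingUnitary := by simp only [mul_assoc, one_mul]
        _ = _ := by rw [← h]; simp only [mul_assoc]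
    -- The square of an odd element is even, hence a scalar, here a positive one; rescaling `S`
    -- gives a symmetry.
    obtain ⟨c, hc⟩ := exists_eq_smul_one hω (mul_mem hS hS)
      (by rw [hmulU, hSU, neg_mul_neg])
    have hcn : c = ((‖S R.ξ‖ ^ 2 : ℝ) : ℂ) := by
      have h1 : inner ℂ R.ξ ((S * S) R.ξ) = ((‖S R.ξ‖ ^ 2 : ℝ) : ℂ) := by
        rw [mul_apply_eq_comp, ← ContinuousLinearMap.adjoint_inner_left,
          ← ContinuousLinearMap.star_eq_adjoint, hSs, inner_self_eq_norm_sq_to_K]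
        norm_cast
      rw [← h1, hc, smul_apply, one_apply_eq_self,
        inner_smul_right, inner_ξ_ξ, mul_one]
    have hc0 : c ≠ 0 := by
      rintro rfl
      rw [zero_smul] at hc
      have h1 := CStarRing.norm_star_mul_self (x := S)
      rw [hSs, hc, norm_zero] at h1
      exact hS0 (norm_eq_zero.mp (mul_self_eq_zero.mp h1.symm))
    set r : ℂ := ((‖S R.ξ‖⁻¹ : ℝ) : ℂ) with hr
    have hrc : r * r * c = 1 := by
      have h1 : (‖S R.ξ‖ : ℂ) ≠ 0 := by
        intro h2
        apply hc0
        rw [hcn]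
        push_cast
        rw [h2]
        simp
      rw [hcn, hr]
      push_cast
      field_simp
    have hTT : (r • S) * (r • S) = 1 := by
      rw [smul_mul_smul_comm, hc, smul_smul, hrc, one_smul]
    have hTU : R.gradingUnitary * (r • S) * R.gradingUnitary = -(r • S) := by
      rw [mul_smul_comm, smul_mul_assoc, hSU, smul_neg]
    have hT : r • S ∈ R.commutant := SMulMemClass.smul_mem _ hS
    refine ⟨r • S, hT, ?_, hTT, hTU, fun X hX => ?_⟩
    · rw [star_smul, hSs, hr, Complex.star_def, Complex.conj_ofReal]
    · obtain ⟨d, hd⟩ := heven X hX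
      have hY := sub_mem hX (gradingUnitary_conj_mem hX)
      -- The odd part of `X` (up to a factor two) times the odd symmetry is even, hence scalar;
      -- since the symmetry squares to `1`, the odd part is a multiple of it.
      obtain ⟨e, he⟩ := exists_eq_smul_one hω (mul_mem hY hT)
        (by
          rw [hmulU, hTU, mul_sub, sub_mul, hUU, ← neg_mul_neg, neg_neg, neg_sub])
      have h1 : X - R.gradingUnitary * X * R.gradingUnitary = e • (r • S) := by
        have h2 := congrArg (· * (r • S)) he
        simp only [mul_assoc _ (r • S), hTT, mul_one, smul_mul_assoc, one_mul] at h2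
        exact h2
      refine ⟨2⁻¹ * d, 2⁻¹ * e, ?_⟩
      rw [mul_smul, mul_smul, ← hd, ← h1]
      module
  · left
    intro X hX
    obtain ⟨d, hd⟩ := heven X hX
    have h1 : X - R.gradingUnitary * X * R.gradingUnitary = 0 := by
      by_contra h0
      exact hodd ⟨_, sub_mem hX (gradingUnitary_conj_mem hX),
        by rw [mul_sub, sub_mul, hUU, neg_sub], h0⟩
    refine ⟨2⁻¹ * d, ?_⟩
    rw [mul_smul, ← hd, ← sub_eq_zero.mp h1]
    module

end Extreme

end GNSRep

theorem norm_le_of_sq_le {C x y z : ℝ} (h : z ^ 2 ≤ C * (x ^ 2 * y ^ 2)) (hx : 0 ≤ x)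
    (hy : 0 ≤ y) : z ≤ √ |C| * (x * y) := by
  refine abs_le_of_sq_le_sq' ?_ (by positivity) |>.2
  rw [mul_pow, Real.sq_sqrt (abs_nonneg C), mul_pow]
  exact h.trans (mul_le_mul_of_nonneg_right (le_abs_self C) (by positivity))

/-- An extreme even state is the average of a state `ψ` and its image under the grading, where `ψ`
is pure, and either even or disjoint from its image. -/
theorem EvenState.IsExtreme.exists_pure {A : Type u} [CStarAlgebra A] {g : Z2Grading A}
    {ω : EvenState g} (hω : ω.IsExtreme) :
    ∃ ψ : A →ₗ[ℂ] ℂ, (∀ a, 0 ≤ ψ (star a * a)) ∧ ψ 1 = 1 ∧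
      (∀ a, ψ a + ψ (g.theta a) = 2 * ω.toFun a) ∧
      (∀ (F : A →ₗ[ℂ] ℂ) (C : ℝ),
        (∀ a b, ‖F (star a * b)‖ ^ 2 ≤ C * ((ψ (star a * a)).re * (ψ (star b * b)).re)) →
          ∀ a, F a = F 1 * ψ a) ∧
      ((∀ a, ψ (g.theta a) = ψ a) ∨ ∀ (F : A →ₗ[ℂ] ℂ) (C : ℝ),
        (∀ a b, ‖F (star a * b)‖ ^ 2 ≤
          C * ((ψ (star a * a)).re * (ψ (g.theta (star b * b))).re)) → F = 0) := by
  -- Purity is expressed as: a functional dominated by `ψ` on both sides is a multiple of `ψ`.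
  -- Disjointness is expressed as: none but zero is dominated by `ψ` on one side and `ψ ∘ θ` on the
  -- other.
  have R := cstarGNSRep _ ω.nonneg
  rcases GNSRep.commutant_dichotomy (R := R) hω with h | ⟨T, hT, hTs, hTT, hTU, hspan⟩
  · refine ⟨ω.toFun, ω.nonneg, ω.map_one, fun a => by rw [ω.even]; ring, fun F C hF a => ?_,
      Or.inl ω.even⟩
    obtain ⟨X, hX, hFX, -⟩ := GNSRep.exists_mem_commutant (R := R) F 1 1 (C := √ |C|)
      (fun a b => norm_le_of_sq_le (by
        rw [one_apply_eq_self, one_apply_eq_self, R.norm_orbit_sq, R.norm_orbit_sq]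
        exact hF a b) (norm_nonneg _) (norm_nonneg _)) (Real.sqrt_nonneg _)
    obtain ⟨c, rfl⟩ := h X hX
    have h1 (b : A) : F b = c * ω.toFun b := by
      rw [hFX, smul_apply, one_apply_eq_self, map_smul, inner_smul_right, R.inner_eq]
    rw [h1 a, h1 1, ω.map_one, mul_one]
  -- The spectral projections of the symmetry `T`. They sum to `1` and are exchanged by the grading
  -- unitary because `T` is odd, so `p` yields `ψ` and `q` yields `ψ ∘ θ`.
  · set p : R.H →L[ℂ] R.H := (2⁻¹ : ℂ) • (1 + T) with hp
    set q : R.H →L[ℂ] R.H := (2⁻¹ : ℂ) • (1 - T) with hq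
    have hpm : p ∈ R.commutant := SMulMemClass.smul_mem _ (add_mem (one_mem _) hT)
    have hqm : q ∈ R.commutant := SMulMemClass.smul_mem _ (sub_mem (one_mem _) hT)
    have hps : star p = p := by
      rw [hp, star_smul, star_add, star_one, hTs]
      simp
    have hqs : star q = q := by
      rw [hq, star_smul, star_sub, star_one, hTs]
      simp
    have hpq1 : p + q = 1 := by
      rw [hp, hq]
      module
    have hpp : p * p = p := by
      rw [hp, smul_mul_smul_comm, mul_add, add_mul, add_mul, mul_one, one_mul, mul_one, hTT]
      module
    have hqq : q * q = q := by
      rw [hq, smul_mul_smul_comm, mul_sub, sub_mul, sub_mul, mul_one, one_mul, mul_one, hTT]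
      module
    have hpq : p * q = 0 := by
      rw [← sub_eq_of_eq_add' hpq1.symm, mul_sub, mul_one, hpp, sub_self]
    have hqp : q * p = 0 := by
      rw [← sub_eq_of_eq_add' hpq1.symm, sub_mul, one_mul, hpp, sub_self]
    have hpU : R.gradingUnitary * p * R.gradingUnitary = q := by
      rw [hp, hq, mul_smul_comm, smul_mul_assoc, mul_add, add_mul, hTU, mul_one,
        GNSRep.gradingUnitary_mul_self, sub_eq_add_neg]
    have hinner (e : R.H →L[ℂ] R.H) (hes : star e = e) (hee : e * e = e) (v : R.H) :
        inner ℂ v (e v) = ((‖e v‖ ^ 2 : ℝ) : ℂ) := by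
      conv_lhs => rw [← hee, mul_apply_eq_comp, ← ContinuousLinearMap.adjoint_inner_left,
        ← ContinuousLinearMap.star_eq_adjoint, hes, inner_self_eq_norm_sq_to_K]
      norm_cast
    let ψ : A →ₗ[ℂ] ℂ := (2 : ℂ) • R.vectorFunctional p
    have hψ (a : A) : ψ a = 2 * R.vectorFunctional p a := rfl
    have hψθ (a : A) : ψ (g.theta a) = 2 * R.vectorFunctional q a := by
      rw [hψ, GNSRep.vectorFunctional_apply, GNSRep.inner_ξ_π_theta, hpU,
        GNSRep.vectorFunctional_apply]
    have hψsq (a : A) : ψ (star a * a) = ((2 * ‖p (R.orbit a)‖ ^ 2 : ℝ) : ℂ) := by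
      rw [hψ, GNSRep.vectorFunctional_star_mul hpm, hinner p hps hpp]
      push_cast
      ring
    have hψθsq (a : A) : ψ (g.theta (star a * a)) = ((2 * ‖q (R.orbit a)‖ ^ 2 : ℝ) : ℂ) := by
      rw [hψθ, GNSRep.vectorFunctional_star_mul hqm, hinner q hqs hqq]
      push_cast
      ring
    have hsum (a : A) : ψ a + ψ (g.theta a) = 2 * ω.toFun a := by
      rw [hψ, hψθ, ← GNSRep.vectorFunctional_one (R := R), ← mul_add, ← hpq1]
      simp only [GNSRep.vectorFunctional_apply, add_apply, map_add, inner_add_right]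
    have hψ1 : ψ 1 = 1 := by
      have h1 := hsum 1
      rw [_root_.map_one g.theta, ω.map_one] at h1
      linear_combination h1 / 2
    have hXp {X : R.H →L[ℂ] R.H} {c d : ℂ} (h : X = c • 1 + d • T) : X * p = (c + d) • p := by
      rw [h, hp, mul_smul_comm, mul_add, mul_one, add_mul, smul_mul_assoc, smul_mul_assoc, hTT,
        one_mul]
      module
    have hXq {X : R.H →L[ℂ] R.H} {c d : ℂ} (h : X = c • 1 + d • T) : X * q = (c - d) • q := by
      rw [h, hq, mul_smul_comm, mul_sub, mul_one, add_mul, smul_mul_assoc, smul_mul_assoc, hTT,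
        one_mul]
      module
    refine ⟨ψ, fun a => ?_, hψ1, hsum, fun F C hF a => ?_, Or.inr fun F C hF => ?_⟩
    · rw [hψsq]
      exact_mod_cast (by positivity : (0 : ℝ) ≤ 2 * ‖p (R.orbit a)‖ ^ 2)
    -- Each `ψ (star a * a) = 2 ‖p a ξ‖²` contributes a factor two, whence `4 * C`. The bound
    -- confines `X` to the range of `p`, where the commutant is scalar.
    · obtain ⟨X, hX, hFX, hbd⟩ := GNSRep.exists_mem_commutant (R := R) F p p (C := √ |4 * C|)
        (fun a b => norm_le_of_sq_le (by
          have h1 := hF a b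
          rw [hψsq, hψsq, Complex.ofReal_re, Complex.ofReal_re] at h1
          linarith) (norm_nonneg _) (norm_nonneg _)) (Real.sqrt_nonneg _)
      obtain ⟨c, d, hcd⟩ := hspan X hX
      have hXq0 : X * q = 0 := by
        ext v
        have h1 := hbd ((X * q) v) (q v)
        rw [← mul_apply_eq_comp p q, hpq, zero_apply, norm_zero, mul_zero, mul_zero] at h1
        exact inner_self_eq_zero.mp (norm_le_zero_iff.mp h1)
      have hXe : X = (c + d) • p := by
        rw [← hXp hcd]
        conv_lhs => rw [← mul_one X, ← hpq1, mul_add, hXq0, add_zero]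
      have h1 (b : A) : F b = (c + d) / 2 * ψ b := by
        rw [hFX, hXe, smul_apply, map_smul, inner_smul_right, hψ, GNSRep.vectorFunctional_apply]
        ring
      rw [h1 a, h1 1, hψ1, mul_one]
    -- Here `X` could only map the range of `q` to that of `p`; but every element of the commutant
    -- is a combination of `p` and `q`, so no such off-diagonal operator exists.
    · obtain ⟨X, hX, hFX, hbd⟩ := GNSRep.exists_mem_commutant (R := R) F p q (C := √ |4 * C|)
        (fun a b => norm_le_of_sq_le (by
          have h1 := hF a b
          rw [hψsq, hψθsq, Complex.ofReal_re, Complex.ofReal_re] at h1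
          linarith) (norm_nonneg _) (norm_nonneg _)) (Real.sqrt_nonneg _)
      obtain ⟨c, d, hcd⟩ := hspan X hX
      have hXp0 : X * p = 0 := by
        ext v
        have h1 := hbd ((X * p) v) (p v)
        rw [← mul_apply_eq_comp q p, hqp, zero_apply, norm_zero, mul_zero, mul_zero] at h1
        exact inner_self_eq_zero.mp (norm_le_zero_iff.mp h1)
      have hXq0 : X * q = 0 := by
        ext v
        have h1 := hbd (q ((X * q) v)) (q v)
        rw [← mul_apply_eq_comp p q, hpq, zero_apply, norm_zero, zero_mul, mul_zero,
          ← ContinuousLinearMap.adjoint_inner_right, ← ContinuousLinearMap.star_eq_adjoint, hqs,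
          ← mul_apply_eq_comp X q, hXq hcd, smul_apply, map_smul, ← mul_apply_eq_comp q q, hqq]
          at h1
        rw [hXq hcd]
        exact inner_self_eq_zero.mp (norm_le_zero_iff.mp h1)
      have hX0 : X = 0 := by rw [← mul_one X, ← hpq1, mul_add, hXp0, hXq0, add_zero]
      ext b
      rw [hFX, hX0]
      simp

/-! ### Reduction to extreme even states. -/

section KreinMilman

variable {A : Type u} [CStarAlgebra A] (g : Z2Grading A)

/-- The even states as a set of functions. -/
def evenStateSet : Set (A → ℂ) := Set.range fun ω : EvenState g => ⇑ω.toFun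

variable {g}

theorem mem_evenStateSet_iff {f : A → ℂ} :
    f ∈ evenStateSet g ↔ (∀ a b, f (a + b) = f a + f b) ∧ (∀ (c : ℂ) a, f (c • a) = c * f a) ∧
      (∀ a, 0 ≤ f (star a * a)) ∧ f 1 = 1 ∧ ∀ a, f (g.theta a) = f a := by
  constructor
  · rintro ⟨ω, rfl⟩
    exact ⟨map_add ω.toFun, map_smul ω.toFun, ω.nonneg, ω.map_one, ω.even⟩
  · rintro ⟨h1, h2, h3, h4, h5⟩
    exact ⟨⟨⟨⟨f, h1⟩, h2⟩, h3, h4, h5⟩, rfl⟩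

/-- In the topology of pointwise convergence the even states form a closed subset of a product of
discs of radius `‖a‖`, which is compact by Tychonoff. -/
theorem isCompact_evenStateSet : IsCompact (evenStateSet g) := by
  have hcl : IsClosed (evenStateSet g) := by
    have e : evenStateSet g =
        (⋂ a, ⋂ b, {f : A → ℂ | f (a + b) = f a + f b}) ∩
        ((⋂ c : ℂ, ⋂ a, {f : A → ℂ | f (c • a) = c * f a}) ∩
        ((⋂ a, {f : A → ℂ | 0 ≤ f (star a * a)}) ∩ ({f : A → ℂ | f 1 = 1} ∩
        ⋂ a, {f : A → ℂ | f (g.theta a) = f a}))) := by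
      ext f
      rw [mem_evenStateSet_iff]
      simp
    rw [e]
    refine IsClosed.inter (isClosed_iInter fun a => isClosed_iInter fun b => ?_) <|
      IsClosed.inter (isClosed_iInter fun c => isClosed_iInter fun a => ?_) <|
      IsClosed.inter (isClosed_iInter fun a => ?_) <|
      IsClosed.inter ?_ (isClosed_iInter fun a => ?_)
    · exact isClosed_eq (by fun_prop) (by fun_prop)
    · exact isClosed_eq (by fun_prop) (by fun_prop)
    · exact isClosed_le (by fun_prop) (by fun_prop)
    · exact isClosed_eq (by fun_prop) (by fun_prop)
    · exact isClosed_eq (by fun_prop) (by fun_prop)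
  refine (isCompact_univ_pi fun a : A => isCompact_closedBall (0 : ℂ) ‖a‖).of_isClosed_subset hcl ?_
  rintro _ ⟨ω, rfl⟩ a -
  rw [mem_closedBall_zero_iff]
  exact norm_map_le_norm ω.nonneg ω.map_one a

theorem convex_evenStateSet : Convex ℝ (evenStateSet g) := by
  intro f hf f' hf' s t hs ht hst
  rw [mem_evenStateSet_iff] at hf hf' ⊢
  obtain ⟨h1, h2, h3, h4, h5⟩ := hf
  obtain ⟨h1', h2', h3', h4', h5'⟩ := hf'
  simp only [Pi.add_apply, Pi.smul_apply]
  refine ⟨fun a b => ?_, fun c a => ?_, fun a => ?_, ?_, fun a => ?_⟩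
  · rw [h1, h1']
    module
  · rw [h2, h2', Complex.real_smul, Complex.real_smul, Complex.real_smul, Complex.real_smul]
    ring
  · exact add_nonneg (smul_nonneg hs (h3 a)) (smul_nonneg ht (h3' a))
  · rw [h4, h4', ← add_smul, hst, one_smul]
  · rw [h5, h5']

theorem EvenState.isExtreme_of_mem_extremePoints {ω : EvenState g}
    (hω : ⇑ω.toFun ∈ (evenStateSet g).extremePoints ℝ) : ω.IsExtreme := by
  intro f₁ f₂ h a
  refine congrFun (mem_extremePoints_iff_left.mp hω |>.2 _ ⟨f₁, rfl⟩ _ ⟨f₂, rfl⟩ ?_) a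
  refine ⟨1 / 2, 1 / 2, by norm_num, by norm_num, by norm_num, ?_⟩
  ext b
  simp only [Pi.add_apply, Pi.smul_apply, Complex.real_smul]
  push_cast
  linear_combination (h b) / 2

/-- An estimate for finite linear combinations of values carries over from the extreme even states
to all even states. -/
theorem EvenState.norm_sum_le_of_isExtreme {ι : Type*} (s : Finset ι) (a : ι → A) (c : ι → ℂ)
    {r : ℝ} (h : ∀ ω : EvenState g, ω.IsExtreme → ‖∑ k ∈ s, ω.toFun (a k) * c k‖ ≤ r)
    (ω : EvenState g) : ‖∑ k ∈ s, ω.toFun (a k) * c k‖ ≤ r := by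
  let L : (A → ℂ) →ₗ[ℝ] ℂ :=
    { toFun f := ∑ k ∈ s, f (a k) * c k
      map_add' f f' := by simp [add_mul, Finset.sum_add_distrib]
      map_smul' t f := by simp [Finset.mul_sum, mul_assoc] }
  have hL : Continuous L := by
    change Continuous fun f : A → ℂ => ∑ k ∈ s, f (a k) * c k
    fun_prop
  have hcl : IsClosed (L ⁻¹' Metric.closedBall 0 r) := Metric.isClosed_closedBall.preimage hL
  have hcv : Convex ℝ (L ⁻¹' Metric.closedBall 0 r) := (convex_closedBall 0 r).linear_preimage L
  have hsub : evenStateSet g ⊆ L ⁻¹' Metric.closedBall 0 r := by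
    rw [← closure_convexHull_extremePoints isCompact_evenStateSet convex_evenStateSet]
    refine closure_minimal (convexHull_min (fun f hf => ?_) hcv) hcl
    obtain ⟨ω, rfl⟩ := extremePoints_subset hf
    rw [Set.mem_preimage, mem_closedBall_zero_iff]
    exact h ω (isExtreme_of_mem_extremePoints hf)
  have := hsub ⟨ω, rfl⟩
  rwa [Set.mem_preimage, mem_closedBall_zero_iff] at this

end KreinMilman

/-! ### Minimality of the spatial norm. -/

namespace FermiProduct

variable {A₁ : Type u} {A₂ : Type v} [CStarAlgebra A₁] [CStarAlgebra A₂]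
  {g₁ : Z2Grading A₁} {g₂ : Z2Grading A₂}

theorem ofTensor_tmul_ne_zero {a : A₁} {b : A₂} (ha : a ≠ 0) (hb : b ≠ 0) :
    ofTensor g₁ g₂ (a ⊗ₜ b) ≠ 0 := by
  intro h
  obtain ⟨ω, hω⟩ := EvenState.exists_map_star_mul_self_ne_zero g₂ hb
  have h1 := congrArg (slice (ω.toFun ∘ₗ LinearMap.mulLeft ℂ (star b))) h
  rw [slice_tmul, map_zero] at h1
  exact (smul_ne_zero hω ha) h1

theorem mem_component_zero_iff {A : Type*} [CStarAlgebra A] {g : Z2Grading A} {a : A} :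
    a ∈ g.component 0 ↔ g.theta a = a := by
  rw [g.mem_component, if_pos rfl]

theorem theta_of_mem_component_one {A : Type*} [CStarAlgebra A] {g : Z2Grading A} {a : A}
    (ha : a ∈ g.component 1) : g.theta a = -a := by
  rw [g.mem_component] at ha
  simpa using ha

section Product

variable {N : FermiProduct g₁ g₂ → ℝ} (K : CStarCompletion N) (Θ : K.C ≃⋆ₐ[ℂ] K.C)

/-- The inclusion of the first factor into a completion. -/
def completionLeft : A₁ →⋆ₐ[ℂ] K.C := K.ι.comp (inclLeft g₁ g₂)

/-- The inclusion of the second factor into a completion. -/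
def completionRight : A₂ →⋆ₐ[ℂ] K.C := K.ι.comp (inclRight g₁ g₂)

variable {K Θ}

theorem completionLeft_mul_completionRight (a : A₁) (b : A₂) :
    completionLeft K a * completionRight K b = K.ι (ofTensor g₁ g₂ (a ⊗ₜ b)) := by
  rw [← inclLeft_mul_inclRight, map_mul]
  rfl

theorem completionRight_mul_completionLeft_of_even (a : A₁) {b : A₂} (hb : b ∈ g₂.component 0) :
    completionRight K b * completionLeft K a = completionLeft K a * completionRight K b := by
  have h := congrArg K.ι (inclRight_mul_inclLeft_of_even (g₁ := g₁) a hb)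
  rwa [map_mul, map_mul] at h

theorem completionRight_mul_completionLeft_of_odd (a : A₁) {b : A₂} (hb : b ∈ g₂.component 1) :
    completionRight K b * completionLeft K a =
      completionLeft K (g₁.theta a) * completionRight K b := by
  have h := congrArg K.ι (inclRight_mul_inclLeft_of_odd (g₁ := g₁) a hb)
  rwa [map_mul, map_mul] at h

theorem completionLeft_mul_completionRight_ne_zero (hN : IsCStarNorm N) {a : A₁} {b : A₂}
    (ha : a ≠ 0) (hb : b ≠ 0) : completionLeft K a * completionRight K b ≠ 0 := by
  intro h
  rw [completionLeft_mul_completionRight] at h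
  have h1 := K.norm_ι (ofTensor g₁ g₂ (a ⊗ₜ b))
  rw [h, norm_zero] at h1
  exact ofTensor_tmul_ne_zero ha hb (hN.eq_zero _ h1.symm)

theorem theta_completionLeft (hΘ : ∀ x, Θ (K.ι x) = K.ι (grading g₁ g₂ x))
    (a : A₁) :
    Θ (completionLeft K a) = completionLeft K (g₁.theta a) := by
  change Θ (K.ι (ofTensor g₁ g₂ (a ⊗ₜ 1))) = K.ι (ofTensor g₁ g₂ (g₁.theta a ⊗ₜ 1))
  rw [hΘ, grading_tmul, map_one]

theorem theta_completionRight (hΘ : ∀ x, Θ (K.ι x) = K.ι (grading g₁ g₂ x))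
    (b : A₂) :
    Θ (completionRight K b) = completionRight K (g₂.theta b) := by
  change Θ (K.ι (ofTensor g₁ g₂ (1 ⊗ₜ b))) = K.ι (ofTensor g₁ g₂ (1 ⊗ₜ g₂.theta b))
  rw [hΘ, grading_tmul, map_one]

/-- A joint extension of a state and an even state, which kills the odd part of the second factor
if the first state is even. -/
theorem exists_joint_extension_completion
    (hΘ : ∀ x, Θ (K.ι x) = K.ι (grading g₁ g₂ x)) (hN : IsCStarNorm N) {ψ : A₁ →ₗ[ℂ] ℂ}
    (hψ : ∀ a, 0 ≤ ψ (star a * a)) (hψ1 : ψ 1 = 1) (ω₂ : EvenState g₂) :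
    ∃ Ω : K.C →ₗ[ℂ] ℂ, (∀ x, 0 ≤ Ω (star x * x)) ∧ Ω 1 = 1 ∧
      (∀ a, Ω (completionLeft K a) = ψ a) ∧
      (∀ b ∈ g₂.component 0, Ω (completionRight K b) = ω₂.toFun b) ∧
      ((∀ a, ψ (g₁.theta a) = ψ a) → ∀ b ∈ g₂.component 1, Ω (completionRight K b) = 0) := by
  obtain ⟨Ω, hΩ, hΩ1, hΩi, hΩj⟩ := exists_joint_extension (completionLeft K) (completionRight K)
    g₂.theta
    (fun a b hb => (completionRight_mul_completionLeft_of_even a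
      (mem_component_zero_iff.mpr hb)).symm)
    (fun a b ha hb => completionLeft_mul_completionRight_ne_zero hN ha hb) hψ hψ1 ω₂.nonneg
    ω₂.map_one
  by_cases heven : ∀ a, ψ (g₁.theta a) = ψ a
  -- Compatibility of the norm enters: averaging over `Θ` keeps the values on the first factor, as
  -- `ψ` is even, and kills odd elements of the second.
  · refine ⟨(2⁻¹ : ℂ) • (Ω + Ω ∘ₗ (Θ : K.C →ₗ[ℂ] K.C)), fun x => ?_, ?_, fun a => ?_,
      fun b hb => ?_, fun _ b hb => ?_⟩
    · change 0 ≤ 2⁻¹ * (Ω (star x * x) + Ω (Θ (star x * x)))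
      rw [map_mul Θ, map_star]
      exact mul_nonneg (inv_nonneg.mpr zero_le_two) (add_nonneg (hΩ _) (hΩ _))
    · change 2⁻¹ * (Ω 1 + Ω (Θ 1)) = 1
      rw [map_one Θ, hΩ1]
      norm_num
    · change 2⁻¹ * (Ω (completionLeft K a) + Ω (Θ (completionLeft K a))) = _
      rw [theta_completionLeft hΘ, hΩi, hΩi, heven]
      ring
    · change 2⁻¹ * (Ω (completionRight K b) + Ω (Θ (completionRight K b))) = _
      have hb' := mem_component_zero_iff.mp hb
      rw [theta_completionRight hΘ, hb', hΩj b hb']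
      ring
    · change 2⁻¹ * (Ω (completionRight K b) + Ω (Θ (completionRight K b))) = 0
      rw [theta_completionRight hΘ, theta_of_mem_component_one hb, map_neg, map_neg]
      ring
  · exact ⟨Ω, hΩ, hΩ1, hΩi, fun b hb => hΩj b (mem_component_zero_iff.mp hb),
      fun h => absurd h heven⟩

/-- Purity or disjointness forces a joint extension `Ω` of `ψ` and `ω₂` to be the product `ψ × ω₂`;
averaged over `Θ` it becomes `ω₁ × ω₂`, and states of `K.C` are contractive. -/
theorem norm_prod_le_of_isExtreme (hΘ : ∀ x, Θ (K.ι x) = K.ι (grading g₁ g₂ x))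
    (hN : IsCStarNorm N) {ω₁ : EvenState g₁} (hω₁ : ω₁.IsExtreme)
    (ω₂ : EvenState g₂) (x : FermiProduct g₁ g₂) : ‖ω₁.prod ω₂ x‖ ≤ N x := by
  obtain ⟨ψ, hψ, hψ1, hsum, hpure, hdisj⟩ := hω₁.exists_pure
  obtain ⟨Ω, hΩ, hΩ1, hΩi, hΩ0, hΩodd⟩ := exists_joint_extension_completion hΘ hN hψ hψ1 ω₂
  have hsq (a : A₁) : Ω (star (completionLeft K a) * completionLeft K a) = ψ (star a * a) := by
    rw [← map_star, ← map_mul, hΩi]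
  let F (b : A₂) : A₁ →ₗ[ℂ] ℂ :=
    Ω ∘ₗ LinearMap.mulRight ℂ (completionRight K b) ∘ₗ (completionLeft K : A₁ →ₗ[ℂ] K.C)
  have hF (b : A₂) (a : A₁) : F b a = Ω (completionLeft K a * completionRight K b) := rfl
  have hF1 (b : A₂) : F b 1 = Ω (completionRight K b) := by rw [hF, map_one, one_mul]
  -- Cauchy–Schwarz, after moving `b` to the left so that it can be estimated by its norm. Here `d`
  -- is `c` for even `b` and `g₁.theta c` for odd `b`.
  have hbd (b : A₂) (a c d : A₁) (hd : completionLeft K c * completionRight K b =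
      completionRight K b * completionLeft K d) :
      ‖F b (star a * c)‖ ^ 2 ≤ ‖b‖ ^ 2 * ((ψ (star a * a)).re * (ψ (star d * d)).re) := by
    have h1 := norm_map_star_mul_sq_le hΩ (completionLeft K a)
      (completionLeft K c * completionRight K b)
    have h2 := map_star_mul_self_map_mul_le hΩ (completionRight K) b (completionLeft K d)
    rw [hF, map_mul (completionLeft K), map_star, mul_assoc]
    refine h1.trans ?_
    rw [hd, hsq]
    rw [hsq] at h2
    have h3 := (Complex.nonneg_iff.mp (hψ a)).1
    calc _ ≤ (ψ (star a * a)).re * (‖b‖ ^ 2 * (ψ (star d * d)).re) := by gcongr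
      _ = _ := by ring
  have hFeven (b : A₂) (hb : b ∈ g₂.component 0) (a : A₁) : F b a = ψ a * ω₂.toFun b := by
    rw [hpure (F b) (‖b‖ ^ 2) (fun a c =>
      hbd b a c c (completionRight_mul_completionLeft_of_even c hb).symm) a, hF1, hΩ0 b hb,
      mul_comm]
  have hFodd (b : A₂) (hb : b ∈ g₂.component 1) (a : A₁) : F b a = ψ a * ω₂.toFun b := by
    have h1 (a c : A₁) : ‖F b (star a * c)‖ ^ 2 ≤
        ‖b‖ ^ 2 * ((ψ (star a * a)).re * (ψ (g₁.theta (star c * c))).re) := by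
      have h2 := hbd b a c (g₁.theta c)
        (by rw [completionRight_mul_completionLeft_of_odd _ hb, g₁.involutive])
      rwa [← map_star, ← map_mul] at h2
    rw [ω₂.map_eq_zero_of_mem hb, mul_zero]
    rcases hdisj with heven | hdisj
    · rw [hpure (F b) (‖b‖ ^ 2) (fun a c => by simpa only [heven] using h1 a c) a, hF1,
        hΩodd heven b hb, zero_mul]
    · rw [hdisj (F b) (‖b‖ ^ 2) h1, LinearMap.zero_apply]
  have hprod (a : A₁) (b : A₂) : Ω (K.ι (ofTensor g₁ g₂ (a ⊗ₜ b))) = ψ a * ω₂.toFun b := by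
    rw [← g₂.proj_zero_add_proj_one b, TensorProduct.tmul_add, map_add, map_add, map_add, map_add,
      mul_add, ← hFeven _ (g₂.proj_mem 0 b), ← hFodd _ (g₂.proj_mem 1 b), hF, hF,
      completionLeft_mul_completionRight, completionLeft_mul_completionRight]
  have hx : ω₁.prod ω₂ x = 2⁻¹ * (Ω (K.ι x) + Ω (Θ (K.ι x))) := by
    induction x using induction_homogeneous with
    | hadd x y hx hy =>
      simp only [map_add, hx, hy]
      ring
    | hmul i j a b _ _ =>
      rw [EvenState.prod_tmul, hΘ, grading_tmul, hprod, hprod, ω₂.even, ← add_mul, hsum]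
      ring
  have hle (y : K.C) : ‖Ω y‖ ≤ ‖y‖ := norm_map_le_norm hΩ hΩ1 y
  have h1 := hle (K.ι x)
  have h2 := (hle (Θ (K.ι x))).trans (NonUnitalStarAlgHom.norm_apply_le Θ (K.ι x))
  have h3 := norm_add_le (Ω (K.ι x)) (Ω (Θ (K.ι x)))
  rw [K.norm_ι] at h1 h2
  rw [hx, norm_mul, norm_inv, RCLike.norm_two]
  linarith

theorem norm_prod_le (hΘ : ∀ x, Θ (K.ι x) = K.ι (grading g₁ g₂ x))
    (hN : IsCStarNorm N) (ω₁ : EvenState g₁) (ω₂ : EvenState g₂)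
    (x : FermiProduct g₁ g₂) : ‖ω₁.prod ω₂ x‖ ≤ N x := by
  obtain ⟨s, hs⟩ := TensorProduct.exists_finset ((ofTensor g₁ g₂).symm x)
  have hx : x = ∑ p ∈ s, ofTensor g₁ g₂ (p.1 ⊗ₜ p.2) := by
    rw [← map_sum, ← hs, LinearEquiv.apply_symm_apply]
  have hω (ω : EvenState g₁) :
      ω.prod ω₂ x = ∑ p ∈ s, ω.toFun p.1 * ω₂.toFun p.2 := by
    conv_lhs => rw [hx, map_sum]
    exact Finset.sum_congr rfl fun p _ => EvenState.prod_tmul _ _ _ _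
  rw [hω]
  refine EvenState.norm_sum_le_of_isExtreme s Prod.fst (fun p => ω₂.toFun p.2) (fun ω h => ?_) ω₁
  rw [← hω]
  exact norm_prod_le_of_isExtreme hΘ hN h ω₂ x

/-- The functional extends continuously to a positive functional on the completion, where `x* x ≤
‖x‖²` bounds left multiplication. -/
theorem norm_π_le_of_norm_le (K : CStarCompletion N) {φ : FermiProduct g₁ g₂ →ₗ[ℂ] ℂ}
    (hφ : ∀ x, 0 ≤ φ (star x * x)) (hle : ∀ x, ‖φ x‖ ≤ N x) (R : GNSRep φ)
    (x : FermiProduct g₁ g₂) : ‖R.π x‖ ≤ N x := by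
  let e : FermiProduct g₁ g₂ →ₗ[ℂ] K.C := (K.ι : FermiProduct g₁ g₂ →ₗ[ℂ] K.C)
  let Ω : K.C →L[ℂ] ℂ := φ.extendOfNorm e
  have hΩ (y : FermiProduct g₁ g₂) : Ω (K.ι y) = φ y :=
    LinearMap.extendOfNorm_eq (e := e) K.dense ⟨1, fun y => by
      change ‖φ y‖ ≤ 1 * ‖K.ι y‖
      rw [one_mul, K.norm_ι]
      exact hle y⟩ y
  have hpos (y : K.C) : 0 ≤ Ω.toLinearMap (star y * y) := by
    change 0 ≤ Ω (star y * y)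
    induction y using K.dense.induction_on with
    | hp => exact isClosed_le (by fun_prop) (by fun_prop)
    | ih y =>
      rw [← map_star, ← map_mul, hΩ]
      exact hφ y
  refine R.norm_π_le (by rw [← K.norm_ι]; exact norm_nonneg _) fun y => ?_
  have h := map_star_mul_self_le hpos (K.ι x) (K.ι y)
  rw [K.norm_ι, ← map_mul, ← map_star, ← map_mul, ← map_star, ← map_mul] at h
  change (Ω (K.ι _)).re ≤ _ * (Ω (K.ι _)).re at h
  rwa [hΩ, hΩ] at h

end Product

theorem spatialNorm_le {N : FermiProduct g₁ g₂ → ℝ} (hN : IsCompatibleNorm N)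
    (x : FermiProduct g₁ g₂) : spatialNorm g₁ g₂ x ≤ N x := by
  obtain ⟨hN, K, Θ, hΘ⟩ := hN
  -- Nonnegativity of the bound covers the empty supremum, when some factor has no even state.
  refine Real.sSup_le ?_ (by rw [← K.norm_ι]; exact norm_nonneg _)
  rintro _ ⟨ω₁, ω₂, R, rfl⟩
  exact norm_π_le_of_norm_le K (ω₁.prod_nonneg ω₂) (norm_prod_le hΘ hN ω₁ ω₂) R x

end FermiProduct

end

theorem mainTheorem1 {A₁ : Type u} {A₂ : Type v} [CStarAlgebra A₁] [CStarAlgebra A₂]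
    (g₁ : Z2Grading A₁) (g₂ : Z2Grading A₂) :
    -- every product of even states has a GNS representation, over which the supremum is taken
    (∀ (ω₁ : EvenState g₁) (ω₂ : EvenState g₂), Nonempty (GNSRep (ω₁.prod ω₂))) ∧
    -- the spatial norm is a compatible C*-norm
    IsCompatibleNorm (FermiProduct.spatialNorm g₁ g₂) ∧
    -- and it is below every compatible C*-norm
    ∀ N : FermiProduct g₁ g₂ → ℝ, IsCompatibleNorm N →
      ∀ x : FermiProduct g₁ g₂, FermiProduct.spatialNorm g₁ g₂ x ≤ N x := by
  exact ⟨fun ω₁ ω₂ => ⟨ω₁.prodGNSRep ω₂⟩, FermiProduct.isCompatibleNorm_spatialNorm g₁ g₂,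
    fun _ hN x => FermiProduct.spatialNorm_le hN x⟩
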